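/- Let $X$ be a proper metric space with a Borel measure $m$. Assume that every operator of multiplication by a function $f\in C_0(X)$ on $L^2(X)=L^2(X,m)$ that is compact is zero (this holds, for instance, if $m$ has no atoms, or if multiplication by $f$ is non-compact for every non-zero $f\in C_0(X)$). Let $D\subset X$ be uniformly discrete ($\inf\{d(x,y):x,y\in D,\ x\neq y\}>0$) and coarsely equivalent to $X$ (there is $C>0$ such that every $x\in X$ has some $y\in D$ with $d(x,y)<C$); equip $D$ with the counting measure. Let $H$ be an infinite-dimensional complex Hilbert space. For a metric measure space $Y$ and a Hilbert space $K$, the Roe algebra $C^*_K(Y)$ is the norm closure, in the bounded operators on $L^2(Y)\otimes K$, of the $*$-algebra of operators $T$ that are locally compact ($Tf$ and $fT$ are compact for all $f\in C_0(Y)$, acting by multiplication) and of finite propagation (there is $R>0$ such that $fTg=0$ whenever $f,g\in C_0(Y)$ have supports at distance greater than $R$). Let $\{\phi_x\}_{x\in D}\subset L^2(X)$ be functions with pairwise disjoint (essential) supports, with $x\in\operatorname{supp}\phi_x$, with the diameters of the supports uniformly bounded, and with $\|\phi_x\|_2=1$; let $p_\phi$ be the orthogonal projection onto the closed linear span of $\{\phi_x:x\in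 D\}$ (a Wannier projection with localization centers $D$). Let $V:\mathbb C\to H$ be an isometry, $V_D=\mathrm{id}\otimes V:\ell^2(D)\to \ell^2(D)\otimes H$, and $i_D(T)=V_DTV_D^*$. Then $p_\phi$ is a projection in $C^*_{\mathbb C}(X)$, $i_D(1)$ is a projection in $C^*_H(D)$, and the following are equivalent: 1. $[p_\phi]=0$ in $K_0(C^*_{\mathbb C}(X))$; 2. $[i_D(1)]=0$ in $K_0(C^*_H(D))$. Here $K_0(A)$, for a not necessarily unital $C^*$-algebra $A$ with unitization $A^+=A\oplus\mathbb C$, is the kernel of $K_0(A^+)\to K_0(\mathbb C)$, and $K_0$ of a unital $C^*$-algebra is the Grothendieck group of the Murray–von Neumann classes of projections in matrices over it. -/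

import Mathlib

open MeasureTheory
open scoped ZeroAtInfty Matrix ENNReal

noncomputable section

namespace WannierRoe

/-! ### Operator `K₀`-theory -/

section KTheory

section MurrayVonNeumann

variable {B : Type*} [Ring B] [StarRing B]
variable {l m n o : Type*} [Fintype l] [Fintype m] [Fintype n] [Fintype o]

/-- Murray-von Neumann equivalence of (square) matrices over `B`, possibly of different sizes:
`p = v* v` and `q = v v*` for some rectangular matrix `v` over `B`. -/
def MvN (p : Matrix m m B) (q : Matrix n n B) : Prop :=
  ∃ v : Matrix n m B, vᴴ * v = p ∧ v * vᴴ = q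

theorem MvN.refl {p : Matrix m m B} (hp : IsStarProjection p) : MvN p p := by
  have h1 : p * p = p := hp.isIdempotentElem
  have h2 : pᴴ = p := hp.isSelfAdjoint
  exact ⟨p, by rw [h2, h1], by rw [h2, h1]⟩

theorem MvN.symm {p : Matrix m m B} {q : Matrix n n B} (h : MvN p q) : MvN q p := by
  obtain ⟨v, h1, h2⟩ := h
  exact ⟨vᴴ, by rw [Matrix.conjTranspose_conjTranspose, h2],
    by rw [Matrix.conjTranspose_conjTranspose, h1]⟩

theorem MvN.trans {p : Matrix m m B} {q : Matrix n n B} {r : Matrix o o B}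
    (hp : IsStarProjection p) (hr : IsStarProjection r) (h : MvN p q) (h' : MvN q r) :
    MvN p r := by
  obtain ⟨v, h1, h2⟩ := h
  obtain ⟨w, h3, h4⟩ := h'
  have hp1 : p * p = p := hp.isIdempotentElem
  have hr1 : r * r = r := hr.isIdempotentElem
  refine ⟨w * v, ?_, ?_⟩
  · calc (w * v)ᴴ * (w * v) = vᴴ * (wᴴ * w) * v := by
          rw [Matrix.conjTranspose_mul]; simp only [Matrix.mul_assoc]
      _ = (vᴴ * v) * (vᴴ * v) := by rw [h3, ← h2]; simp only [Matrix.mul_assoc]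
      _ = p := by rw [h1, hp1]
  · calc (w * v) * (w * v)ᴴ = w * (v * vᴴ) * wᴴ := by
          rw [Matrix.conjTranspose_mul]; simp only [Matrix.mul_assoc]
      _ = (w * wᴴ) * (w * wᴴ) := by rw [h2, ← h3]; simp only [Matrix.mul_assoc]
      _ = r := by rw [h4, hr1]

theorem isStarProjection_submatrix {p : Matrix m m B} (hp : IsStarProjection p) (e : n ≃ m) :
    IsStarProjection (p.submatrix e e) := by
  have h1 : p * p = p := hp.isIdempotentElem
  have h2 : pᴴ = p := hp.isSelfAdjoint
  constructor
  · change p.submatrix e e * p.submatrix e e = _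
    rw [Matrix.submatrix_mul_equiv, h1]
  · change (p.submatrix e e)ᴴ = _
    rw [Matrix.conjTranspose_submatrix, h2]

theorem MvN.submatrix {p : Matrix m m B} (hp : IsStarProjection p) (e : n ≃ m) :
    MvN p (p.submatrix e e) := by
  have h1 : p * p = p := hp.isIdempotentElem
  have h2 : pᴴ = p := hp.isSelfAdjoint
  refine ⟨p.submatrix e id, ?_, ?_⟩
  · rw [Matrix.conjTranspose_submatrix, h2, Matrix.submatrix_mul_equiv, h1, Matrix.submatrix_id_id]
  · rw [Matrix.conjTranspose_submatrix, h2]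
    have := Matrix.submatrix_mul_equiv p p e (Equiv.refl m) e
    simpa [h1] using this

/-- The block sum `p ⊕ q`. -/
def blockSum (p : Matrix m m B) (q : Matrix n n B) : Matrix (m ⊕ n) (m ⊕ n) B :=
  Matrix.fromBlocks p 0 0 q

theorem isStarProjection_blockSum {p : Matrix m m B} {q : Matrix n n B}
    (hp : IsStarProjection p) (hq : IsStarProjection q) : IsStarProjection (blockSum p q) := by
  have h1 : p * p = p := hp.isIdempotentElem
  have h2 : pᴴ = p := hp.isSelfAdjoint
  have h3 : q * q = q := hq.isIdempotentElem
  have h4 : qᴴ = q := hq.isSelfAdjoint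
  constructor
  · change blockSum p q * blockSum p q = _
    simp [blockSum, Matrix.fromBlocks_multiply, h1, h3]
  · change (blockSum p q)ᴴ = _
    simp [blockSum, Matrix.fromBlocks_conjTranspose, h2, h4]

theorem MvN.blockSum {p : Matrix l l B} {p' : Matrix m m B} {q : Matrix n n B}
    {q' : Matrix o o B} (h : MvN p p') (h' : MvN q q') :
    MvN (blockSum p q) (blockSum p' q') := by
  obtain ⟨v, h1, h2⟩ := h
  obtain ⟨w, h3, h4⟩ := h'
  refine ⟨Matrix.fromBlocks v 0 0 w, ?_, ?_⟩ <;>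
  simp [WannierRoe.blockSum, Matrix.fromBlocks_multiply, Matrix.fromBlocks_conjTranspose,
    h1, h2, h3, h4]

end MurrayVonNeumann

/-- A projection in `M_∞(B) = ⋃ₙ Mₙ(B)`: a self-adjoint idempotent in some `Mₙ(B)`. -/
structure Proj (B : Type*) [Ring B] [StarRing B] where
  /-- the size of the matrix -/
  size : ℕ
  /-- the matrix -/
  mat : Matrix (Fin size) (Fin size) B
  isProj : IsStarProjection mat

variable (B : Type*) [Ring B] [StarRing B]

/-- Murray-von Neumann equivalence on the projections in `M_∞(B)`. -/
instance projSetoid : Setoid (Proj B) where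
  r p q := MvN p.mat q.mat
  iseqv :=
    { refl := fun p => MvN.refl p.isProj
      symm := fun h => h.symm
      trans := fun {p _ r} h h' => h.trans p.isProj r.isProj h' }

/-- The set `V(B)` of Murray-von Neumann classes of projections in `M_∞(B)`. -/
def ProjClass : Type _ := Quotient (projSetoid B)

variable {B}

/-- The Murray-von Neumann class of a projection. -/
def ProjClass.mk (p : Proj B) : ProjClass B := Quotient.mk _ p

/-- The sum of projections: the block sum, its index set identified with `Fin (n + m)`. -/
def Proj.add (p q : Proj B) : Proj B where
  size := p.size + q.size
  mat := (blockSum p.mat q.mat).submatrix finSumFinEquiv.symm finSumFinEquiv.symm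
  isProj := isStarProjection_submatrix (isStarProjection_blockSum p.isProj q.isProj) _

/-- The zero projection, of size `0`. -/
def Proj.zero : Proj B where
  size := 0
  mat := 0
  isProj := IsStarProjection.zero _

theorem Proj.add_mvN (p q : Proj B) : MvN (blockSum p.mat q.mat) (p.add q).mat :=
  MvN.submatrix (isStarProjection_blockSum p.isProj q.isProj) _

instance : Add (ProjClass B) where
  add := Quotient.map₂ Proj.add (by
    intro p p' h q q' h'
    exact ((p.add_mvN q).symm.trans (p.add q).isProj
      (isStarProjection_blockSum p'.isProj q'.isProj) (MvN.blockSum h h')).trans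
      (p.add q).isProj (p'.add q').isProj (p'.add_mvN q'))

instance : Zero (ProjClass B) where
  zero := ProjClass.mk Proj.zero

/-- `V(B)` is a commutative monoid under block sums. -/
instance : AddCommMonoid (ProjClass B) where
  nsmul := nsmulRec
  add_assoc := by
    rintro ⟨p⟩ ⟨q⟩ ⟨r⟩
    refine Quotient.sound ?_
    change MvN ((p.add q).add r).mat (p.add (q.add r)).mat
    have hpq := isStarProjection_blockSum p.isProj q.isProj
    have hqr := isStarProjection_blockSum q.isProj r.isProj
    have hL := isStarProjection_blockSum hpq r.isProj
    have hR := isStarProjection_blockSum p.isProj hqr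
    have e1 : MvN ((p.add q).add r).mat (blockSum (blockSum p.mat q.mat) r.mat) :=
      ((p.add q).add_mvN r).symm.trans ((p.add q).add r).isProj hL
        (MvN.blockSum (p.add_mvN q).symm (MvN.refl r.isProj))
    have e2 : MvN (blockSum p.mat (blockSum q.mat r.mat)) (p.add (q.add r)).mat :=
      (MvN.blockSum (MvN.refl p.isProj) (q.add_mvN r)).trans hR (p.add (q.add r)).isProj
        (p.add_mvN (q.add r))
    have e3 : MvN (blockSum (blockSum p.mat q.mat) r.mat)
        (blockSum p.mat (blockSum q.mat r.mat)) := by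
      have := MvN.submatrix hL (Equiv.sumAssoc (Fin p.size) (Fin q.size) (Fin r.size)).symm
      convert this using 1
      ext (i | i | i) (j | j | j) <;> rfl
    exact (e1.trans ((p.add q).add r).isProj hR e3).trans ((p.add q).add r).isProj
      (p.add (q.add r)).isProj e2
  zero_add := by
    rintro ⟨p⟩
    refine Quotient.sound ?_
    change MvN (Proj.zero.add p).mat p.mat
    have h0 := isStarProjection_blockSum (B := B) (Proj.zero (B := B)).isProj p.isProj
    refine (Proj.zero.add_mvN p).symm.trans (Proj.zero.add p).isProj p.isProj ?_
    have : MvN _ _ := MvN.submatrix h0 (Equiv.emptySum (Fin 0) (Fin p.size)).symm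
    exact this
  add_zero := by
    rintro ⟨p⟩
    refine Quotient.sound ?_
    change MvN (p.add Proj.zero).mat p.mat
    have h0 := isStarProjection_blockSum (B := B) p.isProj (Proj.zero (B := B)).isProj
    refine (p.add_mvN Proj.zero).symm.trans (p.add Proj.zero).isProj p.isProj ?_
    have : MvN _ _ := MvN.submatrix h0 (Equiv.sumEmpty (Fin p.size) (Fin 0)).symm
    exact this
  add_comm := by
    rintro ⟨p⟩ ⟨q⟩
    refine Quotient.sound ?_
    change MvN (p.add q).mat (q.add p).mat
    have hpq := isStarProjection_blockSum p.isProj q.isProj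
    have hqp := isStarProjection_blockSum q.isProj p.isProj
    have e3 : MvN (blockSum p.mat q.mat) (blockSum q.mat p.mat) := by
      have := MvN.submatrix hpq (Equiv.sumComm (Fin q.size) (Fin p.size))
      convert this using 1
      ext (i | i) (j | j) <;> rfl
    exact ((p.add_mvN q).symm.trans (p.add q).isProj hqp e3).trans (p.add q).isProj
      (q.add p).isProj (q.add_mvN p)

variable (B) in
/-- `K₀` of a unital `*`-algebra: the Grothendieck group of `V(B)`. -/
abbrev K0Unital : Type _ := Algebra.GrothendieckAddGroup (ProjClass B)

variable {C : Type*} [Ring C] [StarRing C] [Algebra ℂ B] [Algebra ℂ C]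

/-- The image of a projection under a unital `*`-homomorphism, applied entrywise. -/
def Proj.map (f : B →⋆ₐ[ℂ] C) (p : Proj B) : Proj C where
  size := p.size
  mat := p.mat.map f
  isProj := by
    have h1 : p.mat * p.mat = p.mat := p.isProj.isIdempotentElem
    have h2 : p.matᴴ = p.mat := p.isProj.isSelfAdjoint
    constructor
    · change p.mat.map f * p.mat.map f = _
      rw [← Matrix.map_mul, h1]
    · change (p.mat.map f)ᴴ = _
      rw [← Matrix.conjTranspose_map f (fun x => map_star f x), h2]

/-- The monoid homomorphism `V(B) → V(C)` induced by a unital `*`-homomorphism. -/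
def ProjClass.map (f : B →⋆ₐ[ℂ] C) : ProjClass B →+ ProjClass C where
  toFun := Quotient.map (Proj.map f) (by
    rintro p q ⟨v, h1, h2⟩
    refine ⟨v.map f, ?_, ?_⟩
    · change (v.map f)ᴴ * v.map f = p.mat.map f
      rw [← h1, Matrix.map_mul, Matrix.conjTranspose_map f (fun x => map_star f x)]
    · change v.map f * (v.map f)ᴴ = q.mat.map f
      rw [← h2, Matrix.map_mul, Matrix.conjTranspose_map f (fun x => map_star f x)])
  map_zero' := by
    refine Quotient.sound ?_
    change MvN _ _
    have : (Proj.zero.map f).mat = (Proj.zero (B := C)).mat := by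
      ext i; exact i.elim0
    rw [this]
    exact MvN.refl Proj.zero.isProj
  map_add' := by
    rintro ⟨p⟩ ⟨q⟩
    refine Quotient.sound ?_
    change MvN _ _
    have : ((p.add q).map f).mat = ((p.map f).add (q.map f)).mat := by
      change ((blockSum p.mat q.mat).map f).submatrix finSumFinEquiv.symm finSumFinEquiv.symm =
        (blockSum (p.mat.map f) (q.mat.map f)).submatrix finSumFinEquiv.symm finSumFinEquiv.symm
      simp only [blockSum, Matrix.fromBlocks_map, Matrix.map_zero _ (map_zero f)]
    rw [this]
    exact MvN.refl ((p.map f).add (q.map f)).isProj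

/-- The homomorphism `K₀(B) → K₀(C)` induced by a unital `*`-homomorphism. -/
def K0Unital.map (f : B →⋆ₐ[ℂ] C) : K0Unital B →+ K0Unital C :=
  Algebra.GrothendieckAddGroup.lift (Algebra.GrothendieckAddGroup.of.comp (ProjClass.map f))

variable (A : Type*) [NonUnitalRing A] [StarRing A] [Module ℂ A] [IsScalarTower ℂ A A]
  [SMulCommClass ℂ A A] [StarModule ℂ A]

/-- The `*`-homomorphism `A⁺ → ℂ`, `a + λ ↦ λ`, on the unitization `A⁺ = A ⊕ ℂ`. -/
def scalarPart : Unitization ℂ A →⋆ₐ[ℂ] ℂ := Unitization.starLift 0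

theorem scalarPart_inr (a : A) : scalarPart A (a : Unitization ℂ A) = 0 := by
  have h := Unitization.starLift_symm_apply_apply (scalarPart A) a
  rw [scalarPart, Equiv.symm_apply_apply] at h
  exact h.symm

/-- `K₀(A) = ker (K₀(A⁺) → K₀(ℂ))` for a (possibly non-unital) `*`-algebra `A`. -/
def K0 : AddSubgroup (K0Unital (Unitization ℂ A)) := (K0Unital.map (scalarPart A)).ker

variable {A}

/-- A projection in `A` as a `1 × 1` matrix over `A⁺`. -/
def projOfElem (p : A) (hp : IsStarProjection p) : Proj (Unitization ℂ A) where
  size := 1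
  mat := Matrix.of fun _ _ => (p : Unitization ℂ A)
  isProj := by
    have h1 : p * p = p := hp.isIdempotentElem
    have h2 : star p = p := hp.isSelfAdjoint
    constructor
    · refine Matrix.ext fun i j => ?_
      simp [Matrix.mul_apply, ← Unitization.inr_mul, h1]
    · refine Matrix.ext fun i j => ?_
      simp [Matrix.star_apply, ← Unitization.inr_star, h2]

theorem projClass_map_projOfElem (p : A) (hp : IsStarProjection p) :
    ProjClass.map (scalarPart A) (ProjClass.mk (projOfElem p hp)) = 0 := by
  refine Quotient.sound ?_
  change MvN _ _
  refine ⟨0, ?_, ?_⟩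
  · refine Matrix.ext fun i j => ?_
    change _ = scalarPart A (p : Unitization ℂ A)
    rw [scalarPart_inr, Matrix.mul_zero, Matrix.zero_apply]
  · ext i; exact i.elim0

theorem K0Unital.map_of (f : B →⋆ₐ[ℂ] C) (c : ProjClass B) :
    K0Unital.map f (Algebra.GrothendieckAddGroup.of c) =
      Algebra.GrothendieckAddGroup.of (ProjClass.map f c) :=
  DFunLike.congr_fun (Algebra.GrothendieckAddGroup.lift.symm_apply_apply
    (Algebra.GrothendieckAddGroup.of.comp (ProjClass.map f))) c

/-- The class `[p] ∈ K₀(A)` of a projection `p ∈ A`. -/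
def K0.cls (p : A) (hp : IsStarProjection p) : K0 A :=
  ⟨Algebra.GrothendieckAddGroup.of (ProjClass.mk (projOfElem p hp)), by
    rw [K0, AddMonoidHom.mem_ker, K0Unital.map_of, projClass_map_projOfElem, map_zero]⟩

end KTheory

/-! ### Roe algebras -/

section Roe

variable {X : Type*} [MetricSpace X]
variable {E : Type*} [NormedAddCommGroup E] [InnerProductSpace ℂ E] [CompleteSpace E]

/-- `T` is locally compact with respect to the action `ψ` of `C₀(X)`. -/
def IsLocallyCompactOp (ψ : C₀(X, ℂ) →⋆ₙₐ[ℂ] (E →L[ℂ] E)) (T : E →L[ℂ] E) : Prop :=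
  ∀ f : C₀(X, ℂ), IsCompactOperator (T * ψ f) ∧ IsCompactOperator (ψ f * T)

/-- `T` has finite propagation with respect to the action `ψ` of `C₀(X)`. -/
def HasFinitePropagation (ψ : C₀(X, ℂ) →⋆ₙₐ[ℂ] (E →L[ℂ] E)) (T : E →L[ℂ] E) : Prop :=
  ∃ R : ℝ, 0 < R ∧ ∀ f g : C₀(X, ℂ),
    (∀ x ∈ tsupport f, ∀ y ∈ tsupport g, R < dist x y) → ψ f * T * ψ g = 0

/-- The Roe algebra `C*(X, E)`: the norm closure in the bounded operators on `E` of the `*`-algebra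
of locally compact operators of finite propagation. (For the multiplication actions below on a
proper space these operators already form a `*`-algebra, so that `adjoin` adds nothing.) -/
def roeAlgebra (ψ : C₀(X, ℂ) →⋆ₙₐ[ℂ] (E →L[ℂ] E)) : NonUnitalStarSubalgebra ℂ (E →L[ℂ] E) :=
  (NonUnitalStarAlgebra.adjoin ℂ
    {T | IsLocallyCompactOp ψ T ∧ HasFinitePropagation ψ T}).topologicalClosure

variable [MeasurableSpace X] [BorelSpace X] (μ : Measure X)
variable (H : Type*) [NormedAddCommGroup H] [InnerProductSpace ℂ H]

theorem memLp_top (f : C₀(X, ℂ)) : MemLp f ∞ μ := by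
  obtain ⟨c, hc⟩ := f.toBCF.isBounded_range.exists_norm_le
  exact memLp_top_of_bound (map_continuous f).aestronglyMeasurable c
    (Filter.Eventually.of_forall fun x => hc _ ⟨x, rfl⟩)

/-- The operator of multiplication by `f ∈ C₀(X)` on `L²(X) ⊗ H = L²(X; H)`. -/
def mulOp (f : C₀(X, ℂ)) : Lp H 2 μ →L[ℂ] Lp H 2 μ :=
  (ContinuousLinearMap.lsmul ℂ ℂ).holderL μ ∞ 2 2 ((memLp_top μ f).toLp f)

theorem coeFn_mulOp (f : C₀(X, ℂ)) (g : Lp H 2 μ) :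
    mulOp μ H f g =ᵐ[μ] fun x => f x • g x := by
  have h1 := ContinuousLinearMap.coeFn_holder (r := 2)
    (ContinuousLinearMap.lsmul ℂ ℂ) ((memLp_top μ f).toLp f) g
  have h2 := (memLp_top μ f).coeFn_toLp
  filter_upwards [h1, h2] with x hx hx2
  refine hx.trans ?_
  simp [hx2]

variable [CompleteSpace H]

/-- The standard action of `C₀(X)` on `L²(X) ⊗ H = L²(X; H)` by multiplication. -/
def mulRep : C₀(X, ℂ) →⋆ₙₐ[ℂ] (Lp H 2 μ →L[ℂ] Lp H 2 μ) where
  toFun := mulOp μ H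
  map_smul' c f := by
    ext1 g
    refine Lp.ext ?_
    filter_upwards [coeFn_mulOp μ H (c • f) g, coeFn_mulOp μ H f g,
      Lp.coeFn_smul c (mulOp μ H f g)] with x h1 h2 h3
    rw [h1]
    refine Eq.trans ?_ h3.symm
    simp [h2, mul_smul]
  map_zero' := by
    ext1 g
    refine Lp.ext ?_
    filter_upwards [coeFn_mulOp μ H 0 g, Lp.coeFn_zero H 2 μ] with x h1 h2
    rw [h1]
    refine Eq.trans ?_ h2.symm
    simp
  map_add' f f' := by
    ext1 g
    refine Lp.ext ?_
    filter_upwards [coeFn_mulOp μ H (f + f') g, coeFn_mulOp μ H f g, coeFn_mulOp μ H f' g,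
      Lp.coeFn_add (mulOp μ H f g) (mulOp μ H f' g)] with x h1 h2 h3 h4
    rw [h1]
    refine Eq.trans ?_ h4.symm
    simp [h2, h3, add_smul]
  map_mul' f f' := by
    ext1 g
    refine Lp.ext ?_
    filter_upwards [coeFn_mulOp μ H (f * f') g, coeFn_mulOp μ H f' g,
      coeFn_mulOp μ H f (mulOp μ H f' g)] with x h1 h2 h3
    rw [h1]
    refine Eq.trans ?_ h3.symm
    simp [h2, mul_smul]
  map_star' f := by
    rw [ContinuousLinearMap.star_eq_adjoint, ContinuousLinearMap.eq_adjoint_iff]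
    intro g h
    rw [L2.inner_def, L2.inner_def]
    refine integral_congr_ae ?_
    filter_upwards [coeFn_mulOp μ H (star f) g, coeFn_mulOp μ H f h] with x h1 h2
    rw [h1, h2]
    simp [inner_smul_left, inner_smul_right]

/-- The Roe algebra `C*_H(X)`, acting on `L²(X) ⊗ H = L²(X; H)`. -/
abbrev roeL2 : NonUnitalStarSubalgebra ℂ (Lp H 2 μ →L[ℂ] Lp H 2 μ) := roeAlgebra (mulRep μ H)

variable {H}

/-- `V_X = id ⊗ v : L²(X) → L²(X) ⊗ H` for an isometry `v : ℂ → H`. -/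
def ampIso (v : ℂ →ₗᵢ[ℂ] H) : Lp ℂ 2 μ →L[ℂ] Lp H 2 μ :=
  v.toContinuousLinearMap.compLpL 2 μ

/-- The map `i_X(T) = V_X T V_X*`. -/
def iMap (v : ℂ →ₗᵢ[ℂ] H) (T : Lp ℂ 2 μ →L[ℂ] Lp ℂ 2 μ) : Lp H 2 μ →L[ℂ] Lp H 2 μ :=
  ampIso μ v ∘L T ∘L ContinuousLinearMap.adjoint (ampIso μ v)

end Roe

/-! ### Wannier bases -/

section Wannier

variable {X : Type*} [MetricSpace X] [MeasurableSpace X] [BorelSpace X] {μ : Measure X}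

/-- The support of (the class of) an `L²`-function: the closed set of all points `x` such that `φ`
does not vanish almost everywhere on any neighbourhood of `x`. -/
def essSupp (φ : Lp ℂ 2 μ) : Set X :=
  {x | ∀ U ∈ nhds x, ¬ (∀ᵐ y ∂μ.restrict U, φ y = 0)}

/-- A `D`-compactly supported Wannier basis `{φ_x : x ∈ D}` in `L²(X)`. -/
structure IsWannierBasis (D : Set X) (φ : D → Lp ℂ 2 μ) : Prop where
  disjoint_supp : ∀ x y : D, x ≠ y → Disjoint (essSupp (φ x)) (essSupp (φ y))
  mem_supp : ∀ x : D, (x : X) ∈ essSupp (φ x)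
  diam_bdd : ∃ R : ℝ, ∀ x : D, ∀ y ∈ essSupp (φ x), ∀ z ∈ essSupp (φ x), dist y z ≤ R
  norm_one : ∀ x : D, ‖φ x‖ = 1

/-- The orthogonal projection `p_φ` onto the closed linear span `H_φ` of the `φ_x`. -/
def wannierProj {D : Set X} (φ : D → Lp ℂ 2 μ) : Lp ℂ 2 μ →L[ℂ] Lp ℂ 2 μ :=
  (Submodule.span ℂ (Set.range φ)).topologicalClosure.starProjection

/-- `D` is uniformly discrete. -/
def UniformlyDiscrete (D : Set X) : Prop :=
  ∃ ε : ℝ, 0 < ε ∧ ∀ x ∈ D, ∀ y ∈ D, x ≠ y → ε ≤ dist x y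

/-- The inclusion `D ⊂ X` is a coarse equivalence. -/
def CoarselyDense (D : Set X) : Prop :=
  ∃ C : ℝ, 0 < C ∧ ∀ x : X, ∃ y ∈ D, dist x y < C

end Wannier

end WannierRoe

end

set_option linter.unusedSectionVars false

namespace WannierRoe

/-! ### Vanishing of `K₀`-classes -/

section KTheoryTransfer

variable {A : Type*} [NonUnitalRing A] [StarRing A] [Module ℂ A] [IsScalarTower ℂ A A]
  [SMulCommClass ℂ A A] [StarModule ℂ A]
variable {B : Type*} [NonUnitalRing B] [StarRing B] [Module ℂ B] [IsScalarTower ℂ B B]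
  [SMulCommClass ℂ B B] [StarModule ℂ B]

/-! Both Hilbert spaces are orthogonal sums indexed by `D`: L²(X) through a Borel partition of `X`
into pieces of bounded diameter around the points of `D`, and ℓ²(D) ⊗ H through the points
themselves. Local compactness and finite propagation can be read off from these gradings
(`roeL2_eq_gradedRoe`). The problem then becomes symmetric: each projection is onto the closed span
of an orthonormal family whose `d`-th vector lives near `d`, and every summand is
infinite-dimensional. The latter is where compact multiplication operators being zero enters
(`IsWannierBasis.not_finiteDimensional_range`).

The partial isometry `U` sending φ_d to δ_d ⊗ v(1) satisfies `U* U = p_φ` and `U U* = i_D(1)`, but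
it acts between different spaces, so it does not compare the two K-groups. A graded isometry of one
space into the other would do so by conjugation, but the dimensions of the summands may forbid it.

The way out is that `[p] = 0` is witnessed by finitely many operators
(`K0.exists_finset_cls_eq_zero`). Each has compact, hence separable, range in every summand. So all
of them live on a graded subspace with separable summands, and this subspace does embed into the
other space by a graded partial isometry `W` (`IsGrading.exists_partialIsometry`). Conjugation by
`W` is a `*`-homomorphism on the operators living there. It carries `p` to `W p W*`, which is
Murray-von Neumann equivalent to `q` through `U W*` (`K0.cls_eq_zero_of_partialIsometry`).
Exchanging the two spaces gives the converse. -/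

theorem K0.cls_eq_zero_iff (p : A) (hp : IsStarProjection p) :
    K0.cls p hp = 0 ↔
      ∃ c, ProjClass.mk (projOfElem p hp) + c = c := by
  have h1 : K0.cls p hp = 0 ↔ (Algebra.GrothendieckAddGroup.of (ProjClass.mk (projOfElem p hp)) =
      Algebra.GrothendieckAddGroup.of 0) := by
    rw [map_zero, ← Subtype.coe_inj]; rfl
  rw [h1]
  -- Two classes agree in a Grothendieck group exactly when they agree after adding a common
  -- element.
  refine ((AddLocalization.addMonoidOf ⊤).eq_iff_exists).trans ⟨?_, ?_⟩
  · rintro ⟨c, hc⟩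
    exact ⟨c, by rw [add_comm, hc, add_zero]⟩
  · rintro ⟨c, hc⟩
    exact ⟨⟨c, trivial⟩, by rw [add_zero, add_comm]; exact hc⟩

theorem ProjClass.map_projOfElem (f : A →⋆ₙₐ[ℂ] B) (p : A) (hp : IsStarProjection p)
    (hfp : IsStarProjection (f p)) :
    ProjClass.map (Unitization.starMap f) (ProjClass.mk (projOfElem p hp)) =
      ProjClass.mk (projOfElem (f p) hfp) := by
  refine congrArg ProjClass.mk ?_
  simp only [Proj.map, projOfElem, Proj.mk.injEq, heq_eq_eq, true_and]
  ext i j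
  · simp
  · simp

/-- The stabilizing class `c` is pushed forward along the unitized homomorphism. -/
theorem K0.cls_map_eq_zero (f : A →⋆ₙₐ[ℂ] B) (p : A) (hp : IsStarProjection p)
    (hfp : IsStarProjection (f p)) (h : K0.cls p hp = 0) : K0.cls (f p) hfp = 0 := by
  obtain ⟨c, hc⟩ := (K0.cls_eq_zero_iff p hp).1 h
  refine (K0.cls_eq_zero_iff _ _).2 ⟨ProjClass.map (Unitization.starMap f) c, ?_⟩
  rw [← ProjClass.map_projOfElem f p hp, ← map_add, hc]

theorem K0.cls_eq_of_mvN (p q : A) (hp : IsStarProjection p) (hq : IsStarProjection q) (w : A)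
    (h1 : star w * w = p) (h2 : w * star w = q) : K0.cls p hp = K0.cls q hq := by
  have : ProjClass.mk (projOfElem p hp) = ProjClass.mk (projOfElem q hq) := by
    have key : MvN (Matrix.of fun _ _ : Fin 1 => (p : Unitization ℂ A))
        (Matrix.of fun _ _ : Fin 1 => (q : Unitization ℂ A)) := by
      refine ⟨Matrix.of fun _ _ => (w : Unitization ℂ A), ?_, ?_⟩
      · refine Matrix.ext fun i j => ?_
        simp [Matrix.mul_apply, ← Unitization.inr_mul, ← Unitization.inr_star, h1]
      · refine Matrix.ext fun i j => ?_
        simp [Matrix.mul_apply, ← Unitization.inr_mul, ← Unitization.inr_star, h2]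
    exact Quotient.sound key
  exact Subtype.ext (congrArg Algebra.GrothendieckAddGroup.of this)

/-- A vanishing `K₀`-class already vanishes in every subalgebra which contains a suitable finite
set, the entries of the matrices which witness the vanishing. -/
theorem K0.exists_finset_cls_eq_zero (p : A) (hp : IsStarProjection p) (h : K0.cls p hp = 0) :
    ∃ s : Set A, s.Finite ∧ ∀ (A₀ : NonUnitalStarSubalgebra ℂ A) (p₀ : A₀)
      (hp₀ : IsStarProjection p₀), (p₀ : A) = p → s ⊆ A₀ → K0.cls p₀ hp₀ = 0 := by
  obtain ⟨c, hc⟩ := (K0.cls_eq_zero_iff p hp).1 h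
  obtain ⟨r, rfl⟩ := Quotient.exists_rep c
  obtain ⟨w, hw1, hw2⟩ : MvN ((projOfElem p hp).add r).mat r.mat := Quotient.exact hc
  -- Only the `A`-components of the entries matter, since the scalars lie in every unitization.
  refine ⟨Set.range (fun ij : Fin r.size × Fin r.size => (r.mat ij.1 ij.2).snd) ∪
    Set.range (fun ij : Fin r.size × Fin (1 + r.size) => (w ij.1 ij.2).snd),
    (Set.finite_range _).union (Set.finite_range _), ?_⟩
  rintro A₀ p₀ hp₀ rfl hs
  let ι := NonUnitalStarSubalgebraClass.subtype A₀
  have hι : Function.Injective ι := Subtype.val_injective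
  let J := Unitization.starMap ι
  have hJ : Function.Injective J := Unitization.starMap_injective hι
  have lift : ∀ x : Unitization ℂ A, x.snd ∈ A₀ → ∃ y, J y = x := by
    intro x hx
    refine ⟨Unitization.inl x.fst + Unitization.inr ⟨x.snd, hx⟩, ?_⟩
    rw [map_add, Unitization.starMap_inl, Unitization.starMap_inr]
    exact Unitization.inl_fst_add_inr_snd_eq x
  have hr : ∀ i j, ∃ y, J y = r.mat i j := fun i j => lift _ (hs (Or.inl ⟨(i, j), rfl⟩))
  have hv : ∀ i j, ∃ y, J y = w i j := fun i j => lift _ (hs (Or.inr ⟨(i, j), rfl⟩))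
  choose r₀ hr₀ using hr
  choose w₀ hw₀ using hv
  -- Entrywise injectivity of `J` lets every matrix identity be verified over the larger
  -- unitization.
  have hmat : Function.Injective
      fun M : Matrix (Fin r.size) (Fin r.size) (Unitization ℂ A₀) => M.map J :=
    fun _ _ h => Matrix.ext fun i j => hJ (congrFun (congrFun h i) j)
  have hmat' : Function.Injective
      fun M : Matrix (Fin (1 + r.size)) (Fin (1 + r.size)) (Unitization ℂ A₀) => M.map J :=
    fun _ _ h => Matrix.ext fun i j => hJ (congrFun (congrFun h i) j)
  have hr₁ : (Matrix.of r₀).map J = r.mat := Matrix.ext hr₀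
  have hw₁ : (Matrix.of w₀).map J = w := Matrix.ext hw₀
  have hstar : ∀ {k l : ℕ} (M : Matrix (Fin k) (Fin l) (Unitization ℂ A₀)),
      Mᴴ.map J = (M.map J)ᴴ := fun M => Matrix.conjTranspose_map J (fun x => map_star J x)
  let r' : Proj (Unitization ℂ A₀) :=
    { size := r.size
      mat := Matrix.of r₀
      isProj := by
        constructor
        · refine hmat ?_
          change (Matrix.of r₀ * Matrix.of r₀).map J = (Matrix.of r₀).map J
          rw [Matrix.map_mul, hr₁]
          exact r.isProj.isIdempotentElem
        · refine hmat ?_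
          change (Matrix.of r₀)ᴴ.map J = (Matrix.of r₀).map J
          rw [hstar, hr₁]
          exact r.isProj.isSelfAdjoint }
  refine (K0.cls_eq_zero_iff _ _).2 ⟨ProjClass.mk r', ?_⟩
  refine Quotient.sound ?_
  have hadd : ((projOfElem p₀ hp₀).add r').mat.map J = ((projOfElem (p₀ : A) hp).add r).mat := by
    change ((blockSum (projOfElem p₀ hp₀).mat r'.mat).map J).submatrix
        finSumFinEquiv.symm finSumFinEquiv.symm =
        (blockSum (projOfElem (p₀ : A) hp).mat r.mat).submatrix
          finSumFinEquiv.symm finSumFinEquiv.symm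
    have hpm : (projOfElem p₀ hp₀).mat.map J = (projOfElem (p₀ : A) hp).mat :=
      Matrix.ext fun i j => Unitization.starMap_inr ι p₀
    simp only [blockSum, Matrix.fromBlocks_map, Matrix.map_zero _ (map_zero J)]
    rw [hpm, show r'.mat.map J = r.mat from hr₁]
    rfl
  refine ⟨Matrix.of w₀, hmat' ?_, hmat ?_⟩
  · change ((Matrix.of w₀)ᴴ * Matrix.of w₀).map J = ((projOfElem p₀ hp₀).add r').mat.map J
    rw [Matrix.map_mul, hstar, hw₁, hadd]
    exact hw1
  · change ((Matrix.of w₀) * (Matrix.of w₀)ᴴ).map J = (Matrix.of r₀).map J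
    rw [Matrix.map_mul, hstar, hw₁, hr₁]
    exact hw2

/-- Vanishing of a `K₀`-class is inherited along `*`-homomorphisms which are defined only on
subalgebras that contain any given finite set. -/
theorem K0.cls_eq_zero_of_local (p : A) (hp : IsStarProjection p) (q : B)
    (hq : IsStarProjection q)
    (H : ∀ s : Set A, s.Finite → ∃ (A₀ : NonUnitalStarSubalgebra ℂ A) (hpA₀ : p ∈ A₀)
      (Φ : A₀ →⋆ₙₐ[ℂ] B) (w : B), s ⊆ A₀ ∧ star w * w = Φ ⟨p, hpA₀⟩ ∧ w * star w = q)
    (h : K0.cls p hp = 0) : K0.cls q hq = 0 := by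
  obtain ⟨s, hs, hcls⟩ := K0.exists_finset_cls_eq_zero p hp h
  obtain ⟨A₀, hpA₀, Φ, w, hsA₀, h1, h2⟩ := H s hs
  have hp₀ : IsStarProjection (⟨p, hpA₀⟩ : A₀) :=
    ⟨Subtype.ext hp.isIdempotentElem, Subtype.ext hp.isSelfAdjoint⟩
  have hΦp : IsStarProjection (Φ ⟨p, hpA₀⟩) :=
    ⟨by rw [IsIdempotentElem, ← map_mul, hp₀.isIdempotentElem.eq],
      by rw [IsSelfAdjoint, ← map_star, hp₀.isSelfAdjoint.star_eq]⟩
  rw [← K0.cls_eq_of_mvN _ q hΦp hq w h1 h2]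
  exact K0.cls_map_eq_zero Φ _ hp₀ hΦp (hcls A₀ _ hp₀ rfl hsA₀)

end KTheoryTransfer

/-! ### Partial isometries between orthonormal families -/

section Swap

open ContinuousLinearMap

variable {I : Type*} {E F G E' F' : Type*}
  [NormedAddCommGroup E] [InnerProductSpace ℂ E] [CompleteSpace E]
  [NormedAddCommGroup F] [InnerProductSpace ℂ F] [CompleteSpace F]
  [NormedAddCommGroup G] [InnerProductSpace ℂ G] [CompleteSpace G]
  [NormedAddCommGroup E'] [InnerProductSpace ℂ E'] [CompleteSpace E']
  [NormedAddCommGroup F'] [InnerProductSpace ℂ F'] [CompleteSpace F']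

/-- The isometry `ℓ²(I) → E` given by an orthonormal family. -/
noncomputable def synth {b : I → E} (hb : Orthonormal ℂ b) :
    lp (fun _ : I => ℂ) 2 →L[ℂ] E :=
  hb.orthogonalFamily.linearIsometry.toContinuousLinearMap

theorem synth_single [DecidableEq I] {b : I → E} (hb : Orthonormal ℂ b) (i : I) :
    synth hb (lp.single 2 i 1) = b i := by
  refine (hb.orthogonalFamily.linearIsometry_apply_single (i := i) (1 : ℂ)).trans ?_
  simp

theorem hasSum_synth {b : I → E} (hb : Orthonormal ℂ b) (c : lp (fun _ : I => ℂ) 2) :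
    HasSum (fun i => c i • b i) (synth hb c) := by
  have h := hb.orthogonalFamily.hasSum_linearIsometry c
  simp only [LinearIsometry.toSpanSingleton_apply] at h
  exact h

theorem adjoint_synth_apply {b : I → E} (hb : Orthonormal ℂ b) (x : E) (i : I) :
    adjoint (synth hb) x i = inner ℂ (b i) x := by
  classical
  rw [← synth_single hb i, ← adjoint_inner_right, lp.inner_single_left]
  simp

theorem adjoint_synth_comp_synth {b : I → E} (hb : Orthonormal ℂ b) :
    adjoint (synth hb) ∘L synth hb = 1 := by
  refine ContinuousLinearMap.ext fun c => ext_inner_left ℂ fun d => ?_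
  rw [ContinuousLinearMap.comp_apply, adjoint_inner_right]
  exact hb.orthogonalFamily.linearIsometry.inner_map_map d c

/-- The partial isometry with `a i ↦ b i` which vanishes on the orthogonal complement of the
`a i`. -/
noncomputable def swap {a : I → E} {b : I → F} (ha : Orthonormal ℂ a) (hb : Orthonormal ℂ b) :
    E →L[ℂ] F :=
  synth hb ∘L adjoint (synth ha)

variable {a : I → E} {b : I → F} {c : I → G}
  (ha : Orthonormal ℂ a) (hb : Orthonormal ℂ b) (hc : Orthonormal ℂ c)

theorem adjoint_swap : adjoint (swap ha hb) = swap hb ha := by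
  rw [swap, adjoint_comp, adjoint_adjoint, swap]

theorem swap_comp_swap : swap hb hc ∘L swap ha hb = swap ha hc := by
  have h := adjoint_synth_comp_synth hb
  calc swap hb hc ∘L swap ha hb
      = synth hc ∘L (adjoint (synth hb) ∘L synth hb) ∘L adjoint (synth ha) := rfl
    _ = swap ha hc := by rw [h]; rfl

theorem hasSum_swap (x : E) : HasSum (fun i => inner ℂ (a i) x • b i) (swap ha hb x) := by
  have h := hasSum_synth hb (adjoint (synth ha) x)
  simp only [adjoint_synth_apply] at h
  exact h

theorem swap_apply_self (i : I) : swap ha hb (a i) = b i := by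
  classical
  refine (hasSum_swap ha hb (a i)).unique ?_
  have := hasSum_ite_eq i (b i)
  refine this.congr_fun ?_
  intro j
  rw [orthonormal_iff_ite.1 ha j i]
  split_ifs with h
  · rw [h, one_smul]
  · rw [zero_smul]

theorem swap_eq_zero_of_inner {x : E} (hx : ∀ i, inner ℂ (a i) x = 0) : swap ha hb x = 0 := by
  refine (hasSum_swap ha hb x).unique ?_
  simpa only [hx, zero_smul] using hasSum_zero

theorem hasSum_comp_swap_comp (f : F →L[ℂ] F') (e : E' →L[ℂ] E) (x : E') :
    HasSum (fun i => inner ℂ (adjoint e (a i)) x • f (b i)) (f (swap ha hb (e x))) := by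
  simpa only [map_smul, adjoint_inner_left] using (hasSum_swap ha hb (e x)).mapL f

/-- The composite is the strong sum of the rank-one operators ⟨e* a_i, ·⟩ f(b_i), and each term
vanishes. -/
theorem comp_swap_comp_eq_zero (f : F →L[ℂ] F') (e : E' →L[ℂ] E)
    (h : ∀ i, f (b i) = 0 ∨ adjoint e (a i) = 0) : f ∘L swap ha hb ∘L e = 0 := by
  ext x
  refine (hasSum_comp_swap_comp ha hb f e x).unique ?_
  have : (fun i => inner ℂ (adjoint e (a i)) x • f (b i)) = fun _ => 0 := by
    funext i
    rcases h i with h | h <;> simp [h]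
  rw [this]
  exact hasSum_zero

theorem isCompactOperator_smulRight (l : E →L[ℂ] ℂ) (y : F) :
    IsCompactOperator (l.smulRight y) := by
  have h : IsCompactOperator l := isCompactOperator_of_locallyCompactSpace_dom l
  exact h.clm_comp (ContinuousLinearMap.toSpanSingleton ℂ y)

theorem isCompactOperator_finset_sum {J : Type*} (s : Finset J) (T : J → E →L[ℂ] F)
    (h : ∀ i ∈ s, IsCompactOperator (T i)) : IsCompactOperator (∑ i ∈ s, T i : E →L[ℂ] F) := by
  classical
  induction s using Finset.induction_on with
  | empty => simpa using! isCompactOperator_zero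
  | insert i s hi ih =>
    rw [Finset.sum_insert hi]
    exact (h i (Finset.mem_insert_self _ _)).add
      (ih fun j hj => h j (Finset.mem_insert_of_mem hj))

/-- Only finitely many terms of the rank-one expansion survive, so the composite has finite rank. -/
theorem isCompactOperator_comp_swap_comp (f : F →L[ℂ] F') (e : E' →L[ℂ] E)
    (h : {i | f (b i) ≠ 0 ∧ adjoint e (a i) ≠ 0}.Finite) :
    IsCompactOperator (f ∘L swap ha hb ∘L e) := by
  have key : f ∘L swap ha hb ∘L e =
      ∑ i ∈ h.toFinset, (innerSL ℂ (adjoint e (a i))).smulRight (f (b i)) := by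
    ext x
    refine (hasSum_comp_swap_comp ha hb f e x).unique ?_
    rw [sum_apply]
    refine hasSum_sum_of_ne_finset_zero fun i hi => ?_
    rw [Set.Finite.mem_toFinset, Set.mem_ofPred_eq, not_and_or, not_not, not_not] at hi
    rcases hi with h | h <;> simp [h]
  rw [key]
  exact isCompactOperator_finset_sum _ _ fun i _ =>
    isCompactOperator_smulRight (innerSL ℂ (adjoint e (a i))) (f (b i))

theorem swap_self_eq_starProjection :
    swap ha ha = (Submodule.span ℂ (Set.range a)).topologicalClosure.starProjection := by
  ext x
  symm
  refine Submodule.eq_starProjection_of_mem_orthogonal ?_ ?_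
  · refine mem_closure_of_tendsto (hasSum_swap ha ha x) (Filter.Eventually.of_forall fun s => ?_)
    exact Submodule.sum_mem _ fun i _ =>
      Submodule.smul_mem _ _ (Submodule.subset_span ⟨i, rfl⟩)
  · rw [Submodule.orthogonal_closure]
    rw [Submodule.mem_orthogonal]
    intro u hu
    induction hu using Submodule.span_induction with
    | mem u hu =>
      obtain ⟨i, rfl⟩ := hu
      rw [inner_sub_right, ← adjoint_inner_left, adjoint_swap, swap_apply_self, sub_self]
    | zero => exact inner_zero_left _
    | add u v _ _ hu hv => rw [inner_add_left, hu, hv, add_zero]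
    | smul r u _ hu => rw [inner_smul_left, hu, mul_zero]

theorem swap_self_apply_of_mem {x : E}
    (hx : x ∈ (Submodule.span ℂ (Set.range a)).topologicalClosure) : swap ha ha x = x := by
  rw [swap_self_eq_starProjection]
  exact Submodule.starProjection_eq_self_iff.2 hx

include ha in
-- Each `x` splits as `swap ha ha x`, in the closed span of the family, plus a vector orthogonal to
-- it.
theorem eq_of_orthonormal {S T : E →L[ℂ] F} (h1 : ∀ i, S (a i) = T (a i))
    (h2 : ∀ x, (∀ i, inner ℂ (a i) x = 0) → S x = T x) : S = T := by
  have h3 : S ∘L swap ha ha = T ∘L swap ha ha := by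
    ext x
    refine ((hasSum_swap ha ha x).mapL S).unique ?_
    simp only [map_smul, h1]
    simpa only [map_smul, ContinuousLinearMap.comp_apply] using (hasSum_swap ha ha x).mapL T
  ext x
  have h4 := h2 (x - swap ha ha x) fun i => by
    rw [inner_sub_right, ← adjoint_inner_left, adjoint_swap, swap_apply_self, sub_self]
  have h5 := DFunLike.congr_fun h3 x
  simp only [ContinuousLinearMap.comp_apply] at h5
  rwa [map_sub, map_sub, h5, sub_left_inj] at h4

end Swap

/-! ### Compact operators, separability and orthonormal sequences -/

section HilbertTools

open ContinuousLinearMap TopologicalSpace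

variable {E F : Type*}
  [NormedAddCommGroup E] [InnerProductSpace ℂ E] [CompleteSpace E]
  [NormedAddCommGroup F] [InnerProductSpace ℂ F] [CompleteSpace F]

/-- The range is a countable union of images of balls, each contained in a compact set. -/
theorem isSeparable_range_of_isCompactOperator {T : E →L[ℂ] F} (hT : IsCompactOperator T) :
    IsSeparable (Set.range T) := by
  have h : Set.range T ⊆ ⋃ n : ℕ, T '' Metric.ball 0 n := by
    rintro _ ⟨x, rfl⟩
    obtain ⟨n, hn⟩ := exists_nat_gt ‖x‖
    exact Set.mem_iUnion.2 ⟨n, x, by simpa using hn, rfl⟩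
  refine (IsSeparable.iUnion fun n : ℕ => ?_).mono h
  obtain ⟨K, hK, hTK⟩ := IsCompactOperator.image_ball_subset_compact (f := (T : E →ₗ[ℂ] F)) hT n
  exact hK.isSeparable.mono hTK

/-- The adjoint of a compact operator between Hilbert spaces is compact. -/
theorem isCompactOperator_adjoint {T : E →L[ℂ] F} (hT : IsCompactOperator T) :
    IsCompactOperator (ContinuousLinearMap.adjoint T) := by
  refine (isCompactOperator_iff_isCompact_closure_image_ball
    ((ContinuousLinearMap.adjoint T : F →L[ℂ] E) : F →ₗ[ℂ] E) one_pos).2 ?_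
  refine TotallyBounded.isCompact_of_isClosed (TotallyBounded.closure ?_) isClosed_closure
  have hc : IsCompactOperator (T ∘L ContinuousLinearMap.adjoint T) := hT.comp_clm _
  have htb : TotallyBounded ((T ∘L ContinuousLinearMap.adjoint T) '' Metric.ball 0 1) :=
    ((IsCompactOperator.isCompact_closure_image_ball
      (f := ((T ∘L ContinuousLinearMap.adjoint T : F →L[ℂ] F) : F →ₗ[ℂ] F))
      hc 1).totallyBounded).subset
      subset_closure
  rw [Metric.totallyBounded_iff] at htb ⊢
  intro ε hε
  -- The estimate ‖T* u‖² ≤ ‖T T* u‖ ‖u‖ is applied to differences `u = y - z` of points of the unit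
  -- ball. Since ‖u‖ ≤ 2, an (ε²/2)-net for the image under `T T*` gives an ε-net for the image
  -- under `T*`.
  obtain ⟨t, ht, htf, hcov⟩ := (Metric.totallyBounded_iff.2 htb).exists_subset
    (Metric.dist_mem_uniformity (show 0 < ε ^ 2 / 2 by positivity))
  obtain ⟨u, hu, hu'⟩ := (Set.exists_subset_image_finite_and (s := Metric.ball (0 : F) 1)
    (f := (T ∘L ContinuousLinearMap.adjoint T)) (p := fun s => s = t)).1 ⟨t, ht, htf, rfl⟩
  obtain ⟨huf, rfl⟩ := hu'
  refine ⟨ContinuousLinearMap.adjoint T '' u, huf.image _, ?_⟩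
  rintro _ ⟨y, hy, rfl⟩
  obtain ⟨_, ⟨z, hz, rfl⟩, hyz⟩ := Set.mem_iUnion₂.1 (hcov ⟨y, hy, rfl⟩)
  refine Set.mem_iUnion₂.2 ⟨_, ⟨z, hz, rfl⟩, ?_⟩
  have h1 : ‖T (ContinuousLinearMap.adjoint T (y - z))‖ < ε ^ 2 / 2 := by
    have : dist ((T ∘L ContinuousLinearMap.adjoint T) y)
      ((T ∘L ContinuousLinearMap.adjoint T) z) < ε ^ 2 / 2 := hyz
    rwa [dist_eq_norm, ← map_sub] at this
  have h2 : ‖y - z‖ ≤ 2 := by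
    have hz' := hu hz
    rw [mem_ball_zero_iff] at hy hz'
    exact (norm_sub_le _ _).trans (by linarith)
  have h3 : ‖ContinuousLinearMap.adjoint T (y - z)‖ ^ 2 < ε ^ 2 := by
    have h4 : inner ℂ (ContinuousLinearMap.adjoint T (y - z))
        (ContinuousLinearMap.adjoint T (y - z)) =
        inner ℂ (T (ContinuousLinearMap.adjoint T (y - z))) (y - z) :=
      adjoint_inner_right _ _ _
    have h6 := norm_inner_le_norm (𝕜 := ℂ) (T (ContinuousLinearMap.adjoint T (y - z))) (y - z)
    rw [← h4, inner_self_eq_norm_sq_to_K, norm_pow] at h6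
    simp only [Complex.coe_algebraMap, Complex.norm_real, norm_norm] at h6
    nlinarith [norm_nonneg (T (ContinuousLinearMap.adjoint T (y - z))), norm_nonneg (y - z)]
  have h5 := lt_of_pow_lt_pow_left₀ 2 hε.le h3
  rw [map_sub] at h5
  rw [Metric.mem_ball, dist_eq_norm]
  exact h5

/-- Distinct members are √2 apart, so the balls of radius 1/2 around them are disjoint. -/
theorem countable_of_orthonormal {I : Type*} {b : I → E} (hb : Orthonormal ℂ b)
    [SeparableSpace E] : Countable I := by
  refine Pairwise.countable_of_isOpen_disjoint (s := fun i => Metric.ball (b i) (1 / 2))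
    (fun i j hij => ?_) (fun i => Metric.isOpen_ball)
    fun i => ⟨b i, Metric.mem_ball_self (by norm_num)⟩
  refine Metric.ball_disjoint_ball ?_
  have h : ‖b i - b j‖ ^ 2 = 2 := by
    have h0 := hb.2 hij
    have h1 := @norm_sub_sq ℂ _ _ _ _ (b i) (b j)
    rw [h0, hb.1 i, hb.1 j] at h1
    rw [h1]; simp; norm_num
  rw [dist_eq_norm]
  nlinarith [norm_nonneg (b i - b j)]

theorem exists_orthonormal_nat_of_not_finiteDimensional (K : Submodule ℂ E)
    (hK : ¬ FiniteDimensional ℂ K) : ∃ g : ℕ → E, Orthonormal ℂ g ∧ ∀ n, g n ∈ K := by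
  let b := Module.Basis.ofVectorSpace ℂ K
  have hinf : Infinite (Module.Basis.ofVectorSpaceIndex ℂ K) := by
    refine not_finite_iff_infinite.1 fun h => hK ?_
    exact Module.Finite.of_basis b
  let ν := Infinite.natEmbedding (Module.Basis.ofVectorSpaceIndex ℂ K)
  have hli : LinearIndependent ℂ (b ∘ ν) := b.linearIndependent.comp ν ν.injective
  have ho := InnerProductSpace.gramSchmidtNormed_orthonormal (𝕜 := ℂ) hli
  exact ⟨fun n => K.subtypeₗᵢ (InnerProductSpace.gramSchmidtNormed ℂ (b ∘ ν) n),
    ho.comp_linearIsometry K.subtypeₗᵢ, fun n => Subtype.coe_prop _⟩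

end HilbertTools

/-! ### Roe algebras of graded Hilbert spaces -/

section Graded

open ContinuousLinearMap TopologicalSpace

variable {D : Type*} {E F : Type*}
  [NormedAddCommGroup E] [InnerProductSpace ℂ E] [CompleteSpace E]
  [NormedAddCommGroup F] [InnerProductSpace ℂ F] [CompleteSpace F]

/-- A decomposition of a Hilbert space as an orthogonal sum of closed subspaces, given by the
projections onto the summands. -/
structure IsGrading (e : D → E →L[ℂ] E) : Prop where
  isStarProjection : ∀ d, IsStarProjection (e d)
  mul_eq_zero : ∀ d d', d ≠ d' → e d * e d' = 0
  eq_zero : ∀ x, (∀ d, e d x = 0) → x = 0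

namespace IsGrading

variable {e : D → E →L[ℂ] E} {f : D → F →L[ℂ] F} (he : IsGrading e) (hf : IsGrading f)
include he

theorem star_eq (d : D) : star (e d) = e d := (he.isStarProjection d).isSelfAdjoint

theorem adjoint_eq (d : D) : adjoint (e d) = e d := he.star_eq d

theorem inner_left (d : D) (x y : E) : inner ℂ (e d x) y = inner ℂ x (e d y) := by
  conv_lhs => rw [← he.adjoint_eq d, adjoint_inner_left]

theorem apply_apply (d : D) (x : E) : e d (e d x) = e d x :=
  DFunLike.congr_fun (he.isStarProjection d).isIdempotentElem x

theorem apply_apply_of_ne {d d' : D} (h : d ≠ d') (x : E) : e d (e d' x) = 0 :=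
  DFunLike.congr_fun (he.mul_eq_zero d d' h) x

include hf in
theorem comp_adjoint {W : E →L[ℂ] F} (hW : ∀ d, W ∘L e d = f d ∘L W) (d : D) :
    e d ∘L adjoint W = adjoint W ∘L f d := by
  have := congrArg adjoint (hW d)
  rwa [adjoint_comp, adjoint_comp, he.adjoint_eq, hf.adjoint_eq] at this

theorem ext {x y : E} (h : ∀ d, e d x = e d y) : x = y :=
  sub_eq_zero.1 (he.eq_zero _ fun d => by rw [map_sub, h, sub_self])

/-- The left components give `T * e d' = 0`. Taking adjoints turns the right factors into left ones,
and the same argument applies to `star T`. -/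
theorem op_eq_zero {T : E →L[ℂ] E} (h : ∀ d d', e d * T * e d' = 0) : T = 0 := by
  have h1 : ∀ d', T * e d' = 0 := fun d' => by
    ext x
    exact he.eq_zero _ fun d => DFunLike.congr_fun (h d d') x
  have h2 : star T = 0 := by
    ext x
    refine he.eq_zero _ fun d => ?_
    have : star (T * e d) = 0 := by rw [h1, star_zero]
    rw [star_mul, he.star_eq] at this
    exact DFunLike.congr_fun this x
  rw [← star_star T, h2, star_zero]

/-- Finite sums suffice throughout: finite propagation over finite balls leaves only finitely many
components, so no convergence question arises. -/
theorem eq_sum {x : E} (s : Finset D) (h : ∀ d ∉ s, e d x = 0) : x = ∑ d ∈ s, e d x := by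
  classical
  refine he.ext fun d => ?_
  rw [map_sum]
  by_cases hd : d ∈ s
  · rw [Finset.sum_eq_single_of_mem d hd fun k _ hk => he.apply_apply_of_ne hk.symm x,
      he.apply_apply]
  · rw [h d hd]
    refine (Finset.sum_eq_zero fun k hk => he.apply_apply_of_ne ?_ x).symm
    rintro rfl
    exact hd hk

theorem orthonormal_sigma {I : D → Type*} {a : ∀ d, I d → E} (ha : ∀ d, Orthonormal ℂ (a d))
    (hea : ∀ d i, e d (a d i) = a d i) :
    Orthonormal ℂ (fun x : Σ d, I d => a x.1 x.2) := by
  refine ⟨fun x => (ha x.1).1 x.2, ?_⟩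
  rintro ⟨d, i⟩ ⟨d', i'⟩ hne
  by_cases h : d = d'
  · subst h
    exact (ha d).2 fun hi => hne (congrArg (Sigma.mk d) hi)
  · change inner ℂ (a d i) (a d' i') = 0
    rw [← hea d i, ← hea d' i', he.inner_left, he.apply_apply_of_ne h, inner_zero_right]

include hf in
theorem swap_comp {I : Type*} {a : I → E} {b : I → F} (ha : Orthonormal ℂ a)
    (hb : Orthonormal ℂ b) (deg : I → D) (hea : ∀ i, e (deg i) (a i) = a i)
    (hfb : ∀ i, f (deg i) (b i) = b i) (d : D) : swap ha hb ∘L e d = f d ∘L swap ha hb := by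
  refine eq_of_orthonormal ha (fun i => ?_) fun x hx => ?_
  · simp only [ContinuousLinearMap.comp_apply, swap_apply_self]
    by_cases h : d = deg i
    · rw [h, hea, hfb, swap_apply_self]
    · rw [← hea, he.apply_apply_of_ne h, ← hfb, hf.apply_apply_of_ne h, map_zero]
  · simp only [ContinuousLinearMap.comp_apply]
    rw [swap_eq_zero_of_inner ha hb hx, map_zero]
    refine swap_eq_zero_of_inner ha hb fun i => ?_
    rw [← he.inner_left]
    by_cases h : d = deg i
    · rw [h, hea, hx]
    · rw [← hea, he.apply_apply_of_ne h, inner_zero_left]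

/-- Countably many operators with locally separable ranges live on a graded subspace that embeds,
respecting the gradings, into any graded Hilbert space with infinite-dimensional summands. -/
theorem exists_partialIsometry (hf : IsGrading f)
    (hinf : ∀ d, ¬ FiniteDimensional ℂ (LinearMap.range (f d : F →ₗ[ℂ] F)))
    {s : Set (E →L[ℂ] E)} (hs : s.Countable)
    (hsep : ∀ T ∈ s, ∀ d, IsSeparable (Set.range (e d * T)) ∧
      IsSeparable (Set.range (e d * star T))) :
    ∃ W : E →L[ℂ] F, (∀ d, W ∘L e d = f d ∘L W) ∧
      ∀ T ∈ s, (adjoint W ∘L W) * T = T ∧ T * (adjoint W ∘L W) = T := by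
  -- The `d`-components of all vectors the operators and their adjoints produce. Their closed span
  -- `K d` is a separable subspace of the `d`-th summand.
  let R : D → Set E := fun d =>
    ⋃ T ∈ s, (Set.range (e d * T) ∪ Set.range (e d * star T))
  have hRsep : ∀ d, IsSeparable (R d) := fun d => by
    have := hs.to_subtype
    have h : R d = ⋃ T : s, (Set.range (e d * T.1) ∪ Set.range (e d * star T.1)) :=
      Set.biUnion_eq_iUnion _ _
    rw [h]
    exact IsSeparable.iUnion fun T => (hsep T.1 T.2 d).1.union (hsep T.1 T.2 d).2
  have hRfix : ∀ d, ∀ x ∈ R d, e d x = x := fun d x hx => by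
    obtain ⟨T, -, hx⟩ := Set.mem_iUnion₂.1 hx
    rcases hx with ⟨y, rfl⟩ | ⟨y, rfl⟩ <;> exact he.apply_apply d _
  let K : D → Submodule ℂ E := fun d => (Submodule.span ℂ (R d)).topologicalClosure
  have hKsep : ∀ d, SeparableSpace (K d) := fun d =>
    ((hRsep d).span (R := ℂ)).closure.separableSpace
  have hKfix : ∀ d, ∀ x ∈ K d, e d x = x := fun d x hx => by
    have h1 : Submodule.span ℂ (R d) ≤ LinearMap.eqLocus (e d : E →ₗ[ℂ] E) LinearMap.id :=
      Submodule.span_le.2 fun x hx => hRfix d x hx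
    have h2 : IsClosed {x | e d x = x} := isClosed_eq (e d).continuous continuous_id
    exact closure_minimal (t := {x | e d x = x}) (fun x hx => h1 hx) h2 hx
  have hKcomp : ∀ d, CompleteSpace (K d) := fun d =>
    (Submodule.isClosed_topologicalClosure _).completeSpace_coe
  choose w b hb using fun d => exists_hilbertBasis ℂ (K d)
  have hw : ∀ d, Countable (w d) := fun d => countable_of_orthonormal (b d).orthonormal
  -- The countable basis of `K d` is matched with part of an orthonormal sequence in the `d`-th
  -- summand of `F`. The partial isometry `W` is this matching, so `W* W` projects onto the closed
  -- span of all the `K d`.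
  choose ν hν using fun d => exists_injective_nat (w d)
  choose g hg hgmem using fun d =>
    exists_orthonormal_nat_of_not_finiteDimensional _ (hinf d)
  have ha := he.orthonormal_sigma (a := fun d (i : w d) => ((b d i : K d) : E))
    (fun d => (b d).orthonormal.comp_linearIsometry (K d).subtypeₗᵢ)
    fun d i => hKfix d _ (Subtype.coe_prop _)
  have hfg : ∀ d n, f d (g d n) = g d n := fun d n => by
    obtain ⟨y, hy⟩ := hgmem d n
    rw [← hy]
    exact hf.apply_apply d y
  have hc := hf.orthonormal_sigma (a := fun d (i : w d) => g d (ν d i))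
    (fun d => (hg d).comp (ν d) (hν d)) fun d i => hfg d _
  refine ⟨swap ha hc, he.swap_comp hf ha hc Sigma.fst (fun x => hKfix x.1 _ (Subtype.coe_prop _))
    fun x => hfg x.1 _, ?_⟩
  rw [adjoint_swap, swap_comp_swap]
  have hP : ∀ d, swap ha ha ∘L e d = e d ∘L swap ha ha :=
    he.swap_comp he ha ha Sigma.fst (fun x => hKfix x.1 _ (Subtype.coe_prop _))
      fun x => hKfix x.1 _ (Subtype.coe_prop _)
  have hmem : ∀ d, ∀ x ∈ K d, swap ha ha x = x := fun d x hx => by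
    refine swap_self_apply_of_mem ha ?_
    refine mem_closure_of_tendsto (((b d).hasSum_repr ⟨x, hx⟩).mapL (K d).subtypeL)
      (Filter.Eventually.of_forall fun t => ?_)
    refine Submodule.sum_mem _ fun i _ => ?_
    rw [map_smul]
    exact Submodule.smul_mem _ _ (Submodule.subset_span ⟨⟨d, i⟩, rfl⟩)
  have hRK : ∀ d, ∀ x ∈ R d, x ∈ K d := fun d x hx =>
    subset_closure (Submodule.subset_span hx)
  have hPT : ∀ T ∈ s, swap ha ha * T = T ∧ swap ha ha * star T = star T := fun T hT => by
    constructor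
    · ext x
      refine he.ext fun d => ?_
      refine (DFunLike.congr_fun (hP d) (T x)).symm.trans (hmem d _ (hRK d _ ?_))
      exact Set.mem_iUnion₂.2 ⟨T, hT, Or.inl ⟨x, rfl⟩⟩
    · ext x
      refine he.ext fun d => ?_
      refine (DFunLike.congr_fun (hP d) (star T x)).symm.trans (hmem d _ (hRK d _ ?_))
      exact Set.mem_iUnion₂.2 ⟨T, hT, Or.inr ⟨x, rfl⟩⟩
  intro T hT
  refine ⟨(hPT T hT).1, ?_⟩
  -- `T P = T` is the adjoint of `P T* = T*`, which is why the ranges of adjoints were included.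
  have h := congrArg star (hPT T hT).2
  rwa [star_mul, star_star, star_eq_adjoint, adjoint_swap] at h

end IsGrading

variable [MetricSpace D]

/-- Local compactness with respect to a grading. -/
def GradedLocallyCompact (e : D → E →L[ℂ] E) (T : E →L[ℂ] E) : Prop :=
  ∀ d, IsCompactOperator (T * e d) ∧ IsCompactOperator (e d * T)

/-- Finite propagation with respect to a grading. -/
def GradedFinitePropagation (e : D → E →L[ℂ] E) (T : E →L[ℂ] E) : Prop :=
  ∃ R : ℝ, 0 < R ∧ ∀ d d', R < dist d d' → e d * T * e d' = 0

/-- The `*`-algebra of locally compact operators of finite propagation on a graded Hilbert space. -/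
noncomputable def gradedCore {e : D → E →L[ℂ] E} (he : IsGrading e)
    (hfin : ∀ (d : D) (r : ℝ), (Metric.closedBall d r).Finite) :
    NonUnitalStarSubalgebra ℂ (E →L[ℂ] E) where
  carrier := {T | GradedLocallyCompact e T ∧ GradedFinitePropagation e T}
  zero_mem' := by
    refine ⟨fun d => ?_, 1, one_pos, fun d d' _ => by rw [mul_zero, zero_mul]⟩
    rw [mul_zero, zero_mul]
    exact ⟨isCompactOperator_zero, isCompactOperator_zero⟩
  add_mem' := by
    rintro S T ⟨hS, R, hR, hSR⟩ ⟨hT, R', hR', hTR⟩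
    refine ⟨fun d => ?_, max R R', lt_max_of_lt_left hR, fun d d' h => ?_⟩
    · rw [mul_add, add_mul]
      exact ⟨(hS d).1.add (hT d).1, (hS d).2.add (hT d).2⟩
    · rw [mul_add, add_mul, hSR d d' ((le_max_left _ _).trans_lt h),
        hTR d d' ((le_max_right _ _).trans_lt h), add_zero]
  smul_mem' := by
    rintro c T ⟨hT, R, hR, hTR⟩
    refine ⟨fun d => ?_, R, hR, fun d d' h => ?_⟩
    · rw [smul_mul_assoc, mul_smul_comm]
      exact ⟨(hT d).1.smul c, (hT d).2.smul c⟩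
    · rw [mul_smul_comm, smul_mul_assoc, hTR d d' h, smul_zero]
  mul_mem' := by
    rintro S T ⟨hS, R, hR, hSR⟩ ⟨hT, R', hR', hTR⟩
    refine ⟨fun d => ?_, R + R', add_pos hR hR', fun d d' h => ?_⟩
    · rw [mul_assoc, ← mul_assoc (e d)]
      exact ⟨(hT d).1.clm_comp S, (hS d).2.comp_clm T⟩
    · ext x
      change e d (S (T (e d' x))) = 0
      -- `T (e d' x)` has components only in the finite ball of radius `R'` about `d'`, and `S`
      -- carries none of these as far as `d`.
      rw [he.eq_sum (x := T (e d' x)) (hfin d' R').toFinset fun k hk => ?_, map_sum, map_sum]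
      · refine Finset.sum_eq_zero fun k hk => ?_
        rw [Set.Finite.mem_toFinset, Metric.mem_closedBall] at hk
        have h1 : R < dist d k := by
          have := dist_triangle d k d'
          linarith
        exact DFunLike.congr_fun (hSR d k h1) _
      · rw [Set.Finite.mem_toFinset, Metric.mem_closedBall, not_le] at hk
        exact DFunLike.congr_fun (hTR k d' hk) x
  star_mem' := by
    rintro T ⟨hT, R, hR, hTR⟩
    refine ⟨fun d => ⟨?_, ?_⟩, R, hR, fun d d' h => ?_⟩
    · have := isCompactOperator_adjoint (hT d).2
      rwa [← star_eq_adjoint, star_mul, he.star_eq] at this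
    · have := isCompactOperator_adjoint (hT d).1
      rwa [← star_eq_adjoint, star_mul, he.star_eq] at this
    · have := congrArg star (hTR d' d (by rwa [dist_comm]))
      rwa [star_mul, star_mul, he.star_eq, he.star_eq, star_zero, ← mul_assoc] at this

/-- The Roe algebra of a graded Hilbert space. -/
noncomputable def gradedRoe {e : D → E →L[ℂ] E} (he : IsGrading e)
    (hfin : ∀ (d : D) (r : ℝ), (Metric.closedBall d r).Finite) :
    NonUnitalStarSubalgebra ℂ (E →L[ℂ] E) :=
  (gradedCore he hfin).topologicalClosure

variable {e : D → E →L[ℂ] E} {f : D → F →L[ℂ] F} (he : IsGrading e) (hf : IsGrading f)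
  (hfin : ∀ (d : D) (r : ℝ), (Metric.closedBall d r).Finite)

theorem mem_gradedRoe_of_locallyCompact {T : E →L[ℂ] E} (hT : GradedLocallyCompact e T)
    (hT' : GradedFinitePropagation e T) : T ∈ gradedRoe he hfin :=
  (gradedCore he hfin).le_topologicalClosure ⟨hT, hT'⟩

theorem isCompactOperator_of_mem_gradedRoe {T : E →L[ℂ] E} (hT : T ∈ gradedRoe he hfin) (d : D) :
    IsCompactOperator (e d * T) := by
  have hcl : IsClosed {S : E →L[ℂ] E | IsCompactOperator (e d * S)} :=
    isClosed_setOfPred_isCompactOperator.preimage (continuous_const.mul continuous_id)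
  exact closure_minimal (fun S hS => (hS.1 d).2) hcl hT

/-- `W` and `W*` intertwine the gradings, so conjugation preserves local compactness and
propagation. Being norm continuous, it then respects closures. -/
theorem conj_mem_gradedRoe {W : E →L[ℂ] F} (hW : ∀ d, W ∘L e d = f d ∘L W) {T : E →L[ℂ] E}
    (hT : T ∈ gradedRoe he hfin) : W ∘L T ∘L adjoint W ∈ gradedRoe hf hfin := by
  have hW' := he.comp_adjoint hf hW
  have hcont : Continuous fun S : E →L[ℂ] E => W ∘L S ∘L adjoint W :=
    continuous_const.clm_comp (continuous_id.clm_comp continuous_const)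
  refine map_mem_closure (f := fun S : E →L[ℂ] E => W ∘L S ∘L adjoint W) hcont hT ?_
  rintro S ⟨hS, R, hR, hSR⟩
  refine ⟨fun d => ⟨?_, ?_⟩, R, hR, fun d d' h => ?_⟩
  · have h1 : (W ∘L S ∘L adjoint W) * f d = W ∘L (S * e d) ∘L adjoint W := by
      calc (W ∘L S ∘L adjoint W) * f d = W ∘L S ∘L (adjoint W ∘L f d) := rfl
        _ = _ := by rw [← hW']; rfl
    rw [h1]
    exact ((hS d).1.comp_clm (adjoint W)).clm_comp W
  · have h1 : f d * (W ∘L S ∘L adjoint W) = W ∘L (e d * S) ∘L adjoint W := by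
      calc f d * (W ∘L S ∘L adjoint W) = (f d ∘L W) ∘L S ∘L adjoint W := rfl
        _ = _ := by rw [← hW]; rfl
    rw [h1]
    exact ((hS d).2.comp_clm (adjoint W)).clm_comp W
  · calc f d * (W ∘L S ∘L adjoint W) * f d' = (f d ∘L W) ∘L S ∘L (adjoint W ∘L f d') := rfl
      _ = W ∘L (e d * S * e d') ∘L adjoint W := by rw [← hW, ← hW']; rfl
      _ = 0 := by rw [hSR d d' h, ContinuousLinearMap.zero_comp, ContinuousLinearMap.comp_zero]

include he in
theorem comp_adjoint_mem_gradedRoe {W : E →L[ℂ] F} (hW : ∀ d, W ∘L e d = f d ∘L W)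
    {U : E →L[ℂ] F} (hUe : ∀ d, IsCompactOperator (U ∘L e d))
    (hfU : ∀ d, IsCompactOperator (f d ∘L U))
    (hUprop : ∃ R : ℝ, 0 < R ∧ ∀ d d', R < dist d d' → f d ∘L U ∘L e d' = 0) :
    U ∘L adjoint W ∈ gradedRoe hf hfin := by
  have hW' := he.comp_adjoint hf hW
  obtain ⟨R, hR, hUR⟩ := hUprop
  refine mem_gradedRoe_of_locallyCompact hf hfin
    (fun d => ⟨?_, (hfU d).comp_clm (adjoint W)⟩) ⟨R, hR, fun d d' h => ?_⟩
  · have h1 : (U ∘L adjoint W) * f d = (U ∘L e d) ∘L adjoint W := by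
      calc (U ∘L adjoint W) * f d = U ∘L (adjoint W ∘L f d) := rfl
        _ = _ := by rw [← hW']; rfl
    rw [h1]
    exact (hUe d).comp_clm (adjoint W)
  · calc f d * (U ∘L adjoint W) * f d' = f d ∘L U ∘L (adjoint W ∘L f d') := rfl
      _ = (f d ∘L U ∘L e d') ∘L adjoint W := by rw [← hW']; rfl
      _ = 0 := by rw [hUR d d' h, ContinuousLinearMap.zero_comp]

/-- The operators in a subalgebra which live on the range of a self-adjoint operator `P`. -/
noncomputable def cornerSubalgebra (A : NonUnitalStarSubalgebra ℂ (E →L[ℂ] E)) (P : E →L[ℂ] E)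
    (hP : star P = P) : NonUnitalStarSubalgebra ℂ A where
  carrier := {a | P * (a : E →L[ℂ] E) = a ∧ (a : E →L[ℂ] E) * P = a}
  zero_mem' := ⟨mul_zero P, zero_mul P⟩
  add_mem' := fun {a b} ha hb =>
    ⟨(mul_add P a.1 b.1).trans (congrArg₂ (· + ·) ha.1 hb.1),
      (add_mul a.1 b.1 P).trans (congrArg₂ (· + ·) ha.2 hb.2)⟩
  smul_mem' := fun c a ha =>
    ⟨(mul_smul_comm c P a.1).trans (congrArg (c • ·) ha.1),
      (smul_mul_assoc c a.1 P).trans (congrArg (c • ·) ha.2)⟩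
  mul_mem' := fun {a b} ha hb =>
    ⟨(mul_assoc P a.1 b.1).symm.trans (congrArg (· * b.1) ha.1),
      (mul_assoc a.1 b.1 P).trans (congrArg (a.1 * ·) hb.2)⟩
  star_mem' := fun {a} ha =>
    ⟨by
      have := congrArg star ha.2
      rwa [star_mul, hP] at this,
    by
      have := congrArg star ha.1
      rwa [star_mul, hP] at this⟩

/-- Conjugation by `W` is multiplicative on the operators which live on the range of `W* W`. -/
noncomputable def conjHom {A : NonUnitalStarSubalgebra ℂ (E →L[ℂ] E)}
    {B : NonUnitalStarSubalgebra ℂ (F →L[ℂ] F)} (W : E →L[ℂ] F)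
    (hP : star (adjoint W ∘L W) = adjoint W ∘L W)
    (hAB : ∀ T ∈ A, W ∘L T ∘L adjoint W ∈ B) :
    cornerSubalgebra A (adjoint W ∘L W) hP →⋆ₙₐ[ℂ] B where
  toFun a := ⟨W ∘L (a.1.1) ∘L adjoint W, hAB _ a.1.2⟩
  map_smul' c a := Subtype.ext (by
    change W ∘L (c • a.1.1) ∘L adjoint W = c • (W ∘L (a.1.1) ∘L adjoint W)
    rw [ContinuousLinearMap.smul_comp, ContinuousLinearMap.comp_smul])
  map_zero' := Subtype.ext (by
    change W ∘L (0 : E →L[ℂ] E) ∘L adjoint W = 0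
    rw [ContinuousLinearMap.zero_comp, ContinuousLinearMap.comp_zero])
  map_add' a b := Subtype.ext (by
    change W ∘L (a.1.1 + b.1.1) ∘L adjoint W =
      W ∘L (a.1.1) ∘L adjoint W + W ∘L (b.1.1) ∘L adjoint W
    rw [ContinuousLinearMap.add_comp, ContinuousLinearMap.comp_add])
  map_mul' a b := Subtype.ext (by
    change W ∘L (a.1.1 * b.1.1) ∘L adjoint W =
      (W ∘L a.1.1 ∘L adjoint W) * (W ∘L b.1.1 ∘L adjoint W)
    -- Writing `a` as `a W* W` inserts the factor needed between `a` and `b`.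
    conv_lhs => rw [← a.2.2]
    rfl)
  map_star' a := Subtype.ext (by
    change W ∘L (adjoint a.1.1) ∘L adjoint W = adjoint (W ∘L (a.1.1) ∘L adjoint W)
    rw [adjoint_comp, adjoint_comp, adjoint_adjoint]
    rfl)

include he hf in
-- The equivalence is given by `w = U W*`: here `w* w = W p W*` is the image of `p`, while `w w* = U
-- (W* W) U*` equals `q` because `W* W` fixes the range of `U*`.
theorem K0.cls_eq_zero_of_partialIsometry
    (hinf : ∀ d, ¬ FiniteDimensional ℂ (LinearMap.range (f d : F →ₗ[ℂ] F)))
    {A : NonUnitalStarSubalgebra ℂ (E →L[ℂ] E)} (hA : A = gradedRoe he hfin)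
    {B : NonUnitalStarSubalgebra ℂ (F →L[ℂ] F)} (hB : B = gradedRoe hf hfin)
    {U : E →L[ℂ] F} (hUU : U ∘L adjoint U ∘L U = U)
    (hUe : ∀ d, IsCompactOperator (U ∘L e d))
    (hfU : ∀ d, IsCompactOperator (f d ∘L U))
    (hUprop : ∃ R : ℝ, 0 < R ∧ ∀ d d', R < dist d d' → f d ∘L U ∘L e d' = 0)
    (p : A) (hp : IsStarProjection p) (q : B) (hq : IsStarProjection q)
    (hpU : (p : E →L[ℂ] E) = adjoint U ∘L U) (hqU : (q : F →L[ℂ] F) = U ∘L adjoint U)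
    (h : K0.cls p hp = 0) : K0.cls q hq = 0 := by
  subst hA hB
  refine K0.cls_eq_zero_of_local p hp q hq (fun s hs => ?_) h
  obtain ⟨W, hW, hWs⟩ := he.exists_partialIsometry hf hinf
    -- Including `p` makes `W* W` act as the identity on the range of `p`, which is the range of
    -- `U*`.
    (s := Subtype.val '' s ∪ {(p : E →L[ℂ] E)})
    ((hs.image _).union (Set.finite_singleton _)).countable (by
      intro T hT d
      have hT' : T ∈ gradedRoe he hfin := by
        rcases hT with ⟨T, -, rfl⟩ | rfl
        · exact T.2
        · exact p.2
      exact ⟨isSeparable_range_of_isCompactOperator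
        (isCompactOperator_of_mem_gradedRoe he hfin hT' d),
        isSeparable_range_of_isCompactOperator
        (isCompactOperator_of_mem_gradedRoe he hfin (star_mem hT') d)⟩)
  have hPstar : star (adjoint W ∘L W) = adjoint W ∘L W := by
    rw [star_eq_adjoint, adjoint_comp, adjoint_adjoint]
  have hpP := hWs _ (Or.inr rfl)
  have hUU' : adjoint U ∘L U ∘L adjoint U = adjoint U := by
    have := congrArg adjoint hUU
    rwa [adjoint_comp, adjoint_comp, adjoint_adjoint] at this
  have hPU : (adjoint W ∘L W) ∘L adjoint U = adjoint U := by
    have h2 : (adjoint W ∘L W) * (adjoint U ∘L U) = adjoint U ∘L U := by rw [← hpU]; exact hpP.1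
    calc (adjoint W ∘L W) ∘L adjoint U
        = ((adjoint W ∘L W) * (adjoint U ∘L U)) ∘L adjoint U := by
          conv_lhs => rw [← hUU']
          rfl
      _ = adjoint U := by rw [h2]; exact hUU'
  refine ⟨cornerSubalgebra (gradedRoe he hfin) (adjoint W ∘L W) hPstar, hpP,
    conjHom W hPstar fun T hT => conj_mem_gradedRoe he hf hfin hW hT,
    ⟨U ∘L adjoint W, comp_adjoint_mem_gradedRoe he hf hfin hW hUe hfU hUprop⟩,
    fun a ha => hWs _ (Or.inl ⟨a, ha, rfl⟩), Subtype.ext ?_, Subtype.ext ?_⟩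
  · change adjoint (U ∘L adjoint W) ∘L (U ∘L adjoint W) = W ∘L (p : E →L[ℂ] E) ∘L adjoint W
    rw [hpU, adjoint_comp, adjoint_adjoint]
    rfl
  · change (U ∘L adjoint W) ∘L adjoint (U ∘L adjoint W) = q
    rw [hqU, adjoint_comp, adjoint_adjoint]
    calc (U ∘L adjoint W) ∘L (W ∘L adjoint U) = U ∘L ((adjoint W ∘L W) ∘L adjoint U) := rfl
      _ = _ := by rw [hPU]

end Graded

/-! ### The grading of `L²` by a partition -/

section Restrict

variable {Y : Type*} [MeasurableSpace Y] (μ : Measure Y)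
variable (H : Type*) [NormedAddCommGroup H] [InnerProductSpace ℂ H]

theorem memLp_top_indicator {s : Set Y} (hs : MeasurableSet s) :
    MemLp (s.indicator fun _ => (1 : ℂ)) ∞ μ :=
  memLp_top_of_bound (measurable_const.indicator hs).aestronglyMeasurable 1
    (Filter.Eventually.of_forall fun y => by
      refine (norm_indicator_le_norm_self _ _).trans ?_
      simp)

/-- The operator of restriction to a measurable set. -/
noncomputable def restrictOp {s : Set Y} (hs : MeasurableSet s) : Lp H 2 μ →L[ℂ] Lp H 2 μ :=
  (ContinuousLinearMap.lsmul ℂ ℂ).holderL μ ∞ 2 2 ((memLp_top_indicator μ hs).toLp _)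

theorem coeFn_restrictOp {s : Set Y} (hs : MeasurableSet s) (g : Lp H 2 μ) :
    restrictOp μ H hs g =ᵐ[μ] s.indicator g := by
  classical
  have h1 := ContinuousLinearMap.coeFn_holder (r := 2)
    (ContinuousLinearMap.lsmul ℂ ℂ) ((memLp_top_indicator μ hs).toLp _) g
  have h2 := (memLp_top_indicator μ hs).coeFn_toLp
  filter_upwards [h1, h2] with x hx hx2
  refine hx.trans ?_
  rw [hx2]
  by_cases hxs : x ∈ s <;> simp [hxs]

variable {s t : Set Y} (hs : MeasurableSet s) (ht : MeasurableSet t)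

theorem restrictOp_mul_restrictOp :
    restrictOp μ H hs * restrictOp μ H ht = restrictOp μ H (hs.inter ht) := by
  ext1 g
  refine Lp.ext ?_
  filter_upwards [coeFn_restrictOp μ H hs (restrictOp μ H ht g), coeFn_restrictOp μ H ht g,
    coeFn_restrictOp μ H (hs.inter ht) g] with x h1 h2 h3
  refine h1.trans (Eq.trans ?_ h3.symm)
  rw [← Set.indicator_indicator]
  by_cases hx : x ∈ s <;> simp [hx, h2]

theorem restrictOp_add_compl : restrictOp μ H hs + restrictOp μ H hs.compl = 1 := by
  ext1 g
  refine Lp.ext ?_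
  filter_upwards [coeFn_restrictOp μ H hs g, coeFn_restrictOp μ H hs.compl g,
    Lp.coeFn_add (restrictOp μ H hs g) (restrictOp μ H hs.compl g)] with x h1 h2 h3
  refine h3.trans ?_
  rw [Pi.add_apply, h1, h2]
  exact congrFun (Set.indicator_self_add_compl s g) x

theorem restrictOp_apply_eq_zero_iff (g : Lp H 2 μ) :
    restrictOp μ H hs g = 0 ↔ ∀ᵐ y ∂μ, y ∈ s → g y = 0 := by
  rw [Lp.eq_zero_iff_ae_eq_zero]
  constructor
  · intro h
    filter_upwards [h, coeFn_restrictOp μ H hs g] with y h1 h2 hy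
    rw [h2, Set.indicator_of_mem hy] at h1
    exact h1
  · intro h
    filter_upwards [h, coeFn_restrictOp μ H hs g] with y h1 h2
    rw [h2]
    exact Set.indicator_apply_eq_zero.2 h1

theorem restrictOp_empty :
    restrictOp μ H (MeasurableSet.empty : MeasurableSet (∅ : Set Y)) = 0 := by
  ext1 g
  exact (restrictOp_apply_eq_zero_iff μ H _ g).2 (Filter.Eventually.of_forall fun y hy => hy.elim)

theorem isStarProjection_restrictOp [CompleteSpace H] : IsStarProjection (restrictOp μ H hs) := by
  constructor
  · rw [IsIdempotentElem, restrictOp_mul_restrictOp]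
    congr 1
    exact Set.inter_self s
  · rw [IsSelfAdjoint, ContinuousLinearMap.star_eq_adjoint, eq_comm,
      ContinuousLinearMap.eq_adjoint_iff]
    intro g h
    rw [L2.inner_def, L2.inner_def]
    refine integral_congr_ae ?_
    filter_upwards [coeFn_restrictOp μ H hs g, coeFn_restrictOp μ H hs h] with x h1 h2
    rw [h1, h2]
    by_cases hx : x ∈ s <;> simp [hx]

variable {D : Type*} [Countable D] {π : Y → D} (hπ : ∀ d, MeasurableSet (π ⁻¹' {d}))

theorem isGrading_restrictOp [CompleteSpace H] :
    IsGrading fun d => restrictOp μ H (hπ d) where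
  isStarProjection d := isStarProjection_restrictOp μ H (hπ d)
  mul_eq_zero d d' hdd' := by
    rw [restrictOp_mul_restrictOp, ← restrictOp_empty]
    congr 1
    rw [← Set.preimage_inter, Set.singleton_inter_eq_empty.2 (by simpa using hdd'),
      Set.preimage_empty]
  eq_zero g hg := by
    rw [Lp.eq_zero_iff_ae_eq_zero]
    -- Countability of `D` merges the exceptional null sets of the pieces into one.
    have h : ∀ᵐ y ∂μ, ∀ d, y ∈ π ⁻¹' {d} → g y = 0 :=
      ae_all_iff.2 fun d => (restrictOp_apply_eq_zero_iff μ H (hπ d) g).1 (hg d)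
    filter_upwards [h] with y hy
    exact hy (π y) rfl

theorem restrictOp_preimage_eq_sum [CompleteSpace H] (s : Finset D)
    (hs : MeasurableSet (π ⁻¹' (s : Set D))) :
    restrictOp μ H hs = ∑ d ∈ s, restrictOp μ H (hπ d) := by
  ext1 g
  rw [sum_apply]
  have hmul : ∀ d, restrictOp μ H (hπ d) (restrictOp μ H hs g) =
      restrictOp μ H ((hπ d).inter hs) g := fun d =>
    DFunLike.congr_fun (restrictOp_mul_restrictOp μ H (hπ d) hs) g
  rw [(isGrading_restrictOp μ H hπ).eq_sum (x := restrictOp μ H hs g) s fun d hd => ?_]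
  · refine Finset.sum_congr rfl fun d hd => ?_
    rw [hmul]
    congr 2
    refine Set.inter_eq_left.2 (Set.preimage_mono ?_)
    simpa using hd
  · rw [hmul, restrictOp_apply_eq_zero_iff]
    refine Filter.Eventually.of_forall fun y hy => (hd ?_).elim
    obtain ⟨h1, h2⟩ := hy
    have h1' : π y = d := h1
    rw [← h1']
    exact h2

end Restrict

/-! ### Restriction operators against multiplication operators -/

section RestrictMul

variable {Y : Type*} [MetricSpace Y] [MeasurableSpace Y] [BorelSpace Y] (μ : Measure Y)
variable (H : Type*) [NormedAddCommGroup H] [InnerProductSpace ℂ H] [CompleteSpace H]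
variable {s : Set Y} (hs : MeasurableSet s)

theorem restrictOp_mul_mulRep_ae (f : C₀(Y, ℂ)) (g : Lp H 2 μ) :
    (restrictOp μ H hs * mulRep μ H f) g =ᵐ[μ] s.indicator fun y => f y • g y := by
  filter_upwards [coeFn_restrictOp μ H hs (mulOp μ H f g), coeFn_mulOp μ H f g] with x h1 h2
  refine h1.trans ?_
  by_cases hx : x ∈ s <;> simp [hx, h2]

theorem commute_restrictOp_mulRep (f : C₀(Y, ℂ)) :
    mulRep μ H f * restrictOp μ H hs = restrictOp μ H hs * mulRep μ H f := by
  ext1 g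
  refine Lp.ext ?_
  filter_upwards [restrictOp_mul_mulRep_ae μ H hs f g, coeFn_mulOp μ H f (restrictOp μ H hs g),
    coeFn_restrictOp μ H hs g] with x h1 h2 h3
  refine Eq.trans ?_ h1.symm
  refine h2.trans ?_
  rw [h3]
  by_cases hx : x ∈ s <;> simp [hx]

theorem restrictOp_mul_mulRep_of_eqOn_one {f : C₀(Y, ℂ)} (hf : ∀ y ∈ s, f y = 1) :
    restrictOp μ H hs * mulRep μ H f = restrictOp μ H hs := by
  ext1 g
  refine Lp.ext ?_
  filter_upwards [restrictOp_mul_mulRep_ae μ H hs f g, coeFn_restrictOp μ H hs g] with x h1 h2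
  rw [h1, h2]
  by_cases hx : x ∈ s
  · simp [hx, hf x hx]
  · simp [hx]

theorem norm_restrictOp_mul_mulRep_le {f : C₀(Y, ℂ)} {ε : ℝ} (hε : 0 ≤ ε)
    (hf : ∀ y ∈ s, ‖f y‖ ≤ ε) : ‖restrictOp μ H hs * mulRep μ H f‖ ≤ ε := by
  refine ContinuousLinearMap.opNorm_le_bound _ hε fun g => ?_
  refine Lp.norm_le_mul_norm_of_ae_le_mul ?_
  filter_upwards [restrictOp_mul_mulRep_ae μ H hs f g] with x h1
  rw [h1]
  by_cases hx : x ∈ s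
  · rw [Set.indicator_of_mem hx, norm_smul]
    exact mul_le_mul_of_nonneg_right (hf x hx) (norm_nonneg _)
  · rw [Set.indicator_of_notMem hx, norm_zero]
    positivity

theorem restrictOp_mul_mulRep_of_eqOn_zero {f : C₀(Y, ℂ)} (hf : ∀ y ∈ s, f y = 0) :
    restrictOp μ H hs * mulRep μ H f = 0 :=
  norm_le_zero_iff.1 (norm_restrictOp_mul_mulRep_le μ H hs le_rfl fun y hy => by simp [hf y hy])

end RestrictMul

/-! ### Roe algebras in terms of partitions -/

section RoeGraded

variable {Y : Type*} [MetricSpace Y] [ProperSpace Y]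

theorem exists_bump (y : Y) {r R : ℝ} (hrR : r < R) : ∃ f : C₀(Y, ℂ),
    (∀ z ∈ Metric.closedBall y r, f z = 1) ∧ tsupport f ⊆ Metric.closedBall y R := by
  obtain ⟨f, hf1, hf0, hfc, -⟩ := exists_continuous_one_zero_of_isCompact
    (isCompact_closedBall y r) (Metric.isOpen_ball (x := y) (ε := R)).isClosed_compl
    (Set.disjoint_compl_right_iff_subset.2 (Metric.closedBall_subset_ball hrR))
  have hc : HasCompactSupport fun z => (f z : ℂ) :=
    hfc.comp_left (g := fun t : ℝ => (t : ℂ)) Complex.ofReal_zero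
  refine ⟨⟨⟨fun z => (f z : ℂ), by fun_prop⟩, hc.is_zero_at_infty⟩, fun z hz => ?_, ?_⟩
  · change (f z : ℂ) = 1
    rw [hf1 hz]
    simp
  · refine closure_minimal (fun z hz => ?_) Metric.isClosed_closedBall
    by_contra hzR
    refine hz ?_
    change (f z : ℂ) = 0
    rw [hf0 fun h => hzR (Metric.ball_subset_closedBall h)]
    simp

variable [MeasurableSpace Y] [BorelSpace Y] (μ : Measure Y)
variable (H : Type*) [NormedAddCommGroup H] [InnerProductSpace ℂ H] [CompleteSpace H]
variable {D : Type*} [MetricSpace D] [Countable D] {π : Y → D}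
  (hπ : ∀ d, MeasurableSet (π ⁻¹' {d})) {c : D → Y} (hc : Isometry c) {C : ℝ}
  (hC : ∀ y, dist y (c (π y)) ≤ C)
  (hfin : ∀ (d : D) (r : ℝ), (Metric.closedBall d r).Finite)

include hc hC in
theorem dist_center_le_dist_add (y z : Y) : dist (π y) (π z) ≤ dist y z + 2 * C := by
  rw [← hc.dist_eq]
  have h1 := dist_triangle4 (c (π y)) y z (c (π z))
  have h2 := hC y
  have h3 := hC z
  rw [dist_comm] at h2
  linarith

include hc hC in
theorem dist_le_dist_center_add (y z : Y) : dist y z ≤ dist (π y) (π z) + 2 * C := by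
  rw [← hc.dist_eq]
  have h1 := dist_triangle4 y (c (π y)) (c (π z)) z
  have h2 := hC y
  have h3 := hC z
  rw [dist_comm] at h3
  linarith

include hc hC hfin in
theorem finite_image_of_isBounded {B : Set Y} (hB : Bornology.IsBounded B) : (π '' B).Finite := by
  rcases B.eq_empty_or_nonempty with rfl | ⟨y, hy⟩
  · simp
  · obtain ⟨r, hr⟩ := hB.subset_closedBall y
    refine (hfin (π y) (r + 2 * C)).subset ?_
    rintro _ ⟨z, hz, rfl⟩
    have h1 := dist_center_le_dist_add hc hC z y
    have h2 : dist z y ≤ r := hr hz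
    exact Metric.mem_closedBall.2 (by linarith)

include hπ hc hC hfin in
-- The set where |f| ≥ ε is bounded, so it meets only finitely many pieces. Off these the multiplier
-- is smaller than ε.
theorem exists_norm_sub_restrictOp_le (f : C₀(Y, ℂ)) {ε : ℝ} (hε : 0 < ε) : ∃ s : Finset D,
    ‖mulRep μ H f - (∑ d ∈ s, restrictOp μ H (hπ d)) * mulRep μ H f‖ ≤ ε := by
  have hK : Bornology.IsBounded {y | ε ≤ ‖f y‖} := by
    have h1 := f.zero_at_infty'
    have h2 : ∀ᶠ y in Filter.cocompact Y, ‖f y‖ < ε := by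
      have := (tendsto_zero_iff_norm_tendsto_zero.1 h1).eventually (gt_mem_nhds hε)
      exact this
    obtain ⟨K, hK, hKf⟩ := Filter.mem_cocompact.1 h2
    refine hK.isBounded.subset fun y hy => ?_
    by_contra hyK
    have hlt : ‖f y‖ < ε := hKf hyK
    exact absurd hlt (not_lt.2 hy)
  have hF := finite_image_of_isBounded hc hC hfin hK
  have hm : MeasurableSet (π ⁻¹' (hF.toFinset : Set D)) := by
    rw [← Set.biUnion_preimage_singleton]
    exact hF.toFinset.measurableSet_biUnion fun d _ => hπ d
  refine ⟨hF.toFinset, ?_⟩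
  rw [← restrictOp_preimage_eq_sum μ H hπ _ hm]
  have h1 : mulRep μ H f - restrictOp μ H hm * mulRep μ H f =
      restrictOp μ H hm.compl * mulRep μ H f := by
    rw [sub_eq_iff_eq_add', ← add_mul, restrictOp_add_compl, one_mul]
  rw [h1]
  refine norm_restrictOp_mul_mulRep_le μ H _ hε.le fun y hy => ?_
  by_contra hlt
  refine hy ?_
  change π y ∈ (hF.toFinset : Set D)
  rw [Set.Finite.coe_toFinset]
  exact ⟨y, (not_le.1 hlt).le, rfl⟩

include hC in
theorem exists_mulRep_restrictOp (d : D) : ∃ f : C₀(Y, ℂ),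
    restrictOp μ H (hπ d) * mulRep μ H f = restrictOp μ H (hπ d) ∧
    mulRep μ H f * restrictOp μ H (hπ d) = restrictOp μ H (hπ d) ∧
    tsupport f ⊆ Metric.closedBall (c d) (C + 1) := by
  obtain ⟨f, hf1, hf2⟩ := exists_bump (c d) (lt_add_one C)
  have h1 : restrictOp μ H (hπ d) * mulRep μ H f = restrictOp μ H (hπ d) :=
    restrictOp_mul_mulRep_of_eqOn_one μ H _ fun y hy => hf1 y (by
      have h : π y = d := hy
      rw [← h]
      exact hC y)
  exact ⟨f, h1, by rw [commute_restrictOp_mulRep, h1], hf2⟩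

include hc hC hfin in
theorem isLocallyCompactOp_iff (T : Lp H 2 μ →L[ℂ] Lp H 2 μ) :
    IsLocallyCompactOp (mulRep μ H) T ↔
      GradedLocallyCompact (fun d => restrictOp μ H (hπ d)) T := by
  constructor
  · intro hT d
    obtain ⟨f, hf1, hf2, -⟩ := exists_mulRep_restrictOp μ H hπ hC d
    constructor
    · have h : T * restrictOp μ H (hπ d) = (T * mulRep μ H f) * restrictOp μ H (hπ d) := by
        rw [mul_assoc, hf2]
      change IsCompactOperator (T * restrictOp μ H (hπ d))
      rw [h]
      exact (hT f).1.comp_clm _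
    · have h : restrictOp μ H (hπ d) * T = restrictOp μ H (hπ d) * (mulRep μ H f * T) := by
        rw [← mul_assoc, hf1]
      change IsCompactOperator (restrictOp μ H (hπ d) * T)
      rw [h]
      exact (hT f).2.clm_comp (restrictOp μ H (hπ d))
  · intro hT f
    -- `S` is `f` cut down to finitely many pieces, on which graded local compactness applies.
    -- Compactness survives the norm limit.
    have key : ∀ ε > 0, ∃ S : Lp H 2 μ →L[ℂ] Lp H 2 μ, IsCompactOperator (T * S) ∧
        IsCompactOperator (S * T) ∧ ‖mulRep μ H f - S‖ ≤ ε := fun ε hε => by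
      obtain ⟨s, hs⟩ := exists_norm_sub_restrictOp_le μ H hπ hc hC hfin f hε
      refine ⟨_, ?_, ?_, hs⟩
      · rw [← mul_assoc, Finset.mul_sum]
        exact (isCompactOperator_finset_sum s _ fun d _ => (hT d).1).comp_clm _
      · have hcomm : (∑ d ∈ s, restrictOp μ H (hπ d)) * mulRep μ H f =
            mulRep μ H f * ∑ d ∈ s, restrictOp μ H (hπ d) := by
          rw [Finset.mul_sum, Finset.sum_mul]
          exact Finset.sum_congr rfl fun d _ => (commute_restrictOp_mulRep μ H (hπ d) f).symm
        rw [hcomm, mul_assoc, Finset.sum_mul]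
        exact (isCompactOperator_finset_sum s _ fun d _ => (hT d).2).clm_comp
          (mulRep μ H f)
    have hcl : IsClosed {S : Lp H 2 μ →L[ℂ] Lp H 2 μ | IsCompactOperator (T * S) ∧
        IsCompactOperator (S * T)} :=
      (isClosed_setOfPred_isCompactOperator.preimage (continuous_const.mul continuous_id)).inter
        (isClosed_setOfPred_isCompactOperator.preimage (continuous_id.mul continuous_const))
    refine hcl.closure_subset_iff.2 subset_rfl (Metric.mem_closure_iff.2 fun ε hε => ?_)
    obtain ⟨S, h1, h2, h3⟩ := key (ε / 2) (half_pos hε)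
    exact ⟨S, ⟨h1, h2⟩, by rw [dist_eq_norm]; linarith⟩

include hc hC in
theorem hasFinitePropagation_iff (hcC : 0 < C) (T : Lp H 2 μ →L[ℂ] Lp H 2 μ) :
    HasFinitePropagation (mulRep μ H) T ↔
      GradedFinitePropagation (fun d => restrictOp μ H (hπ d)) T := by
  constructor
  · rintro ⟨R, hR, hT⟩
    -- The functions equal to 1 on the two pieces have supports within `C + 1` of the centers, hence
    -- more than `R` apart.
    refine ⟨R + 2 * (C + 1), by positivity, fun d d' h => ?_⟩
    obtain ⟨f, hf1, -, hf3⟩ := exists_mulRep_restrictOp μ H hπ hC d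
    obtain ⟨g, -, hg2, hg3⟩ := exists_mulRep_restrictOp μ H hπ hC d'
    have h0 := hT f g fun x hx y hy => by
      have h1 : dist x (c d) ≤ C + 1 := hf3 hx
      have h2 : dist y (c d') ≤ C + 1 := hg3 hy
      have h3 := dist_triangle4 (c d) x y (c d')
      rw [hc.dist_eq, dist_comm (c d)] at h3
      linarith
    calc restrictOp μ H (hπ d) * T * restrictOp μ H (hπ d')
        = restrictOp μ H (hπ d) * (mulRep μ H f * T * mulRep μ H g) *
            restrictOp μ H (hπ d') := by
          conv_lhs => rw [← hf1, ← hg2]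
          simp only [mul_assoc]
      _ = 0 := by rw [h0, mul_zero, zero_mul]
  · rintro ⟨R, hR, hT⟩
    -- If `f` and `g` are nonzero somewhere on the pieces `d` and `d'`, these points are more than
    -- `R + 2 * C` apart, so the centers are more than `R` apart.
    refine ⟨R + 2 * C, by positivity, fun f g hfg => ?_⟩
    refine (isGrading_restrictOp μ H hπ).op_eq_zero fun d d' => ?_
    have hcalc : restrictOp μ H (hπ d) * (mulRep μ H f * T * mulRep μ H g) *
        restrictOp μ H (hπ d') = (restrictOp μ H (hπ d) * mulRep μ H f) * T *
          (restrictOp μ H (hπ d') * mulRep μ H g) := by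
      rw [← commute_restrictOp_mulRep μ H (hπ d') g]
      simp only [mul_assoc]
    by_cases h1 : ∀ y ∈ π ⁻¹' {d}, f y = 0
    · rw [hcalc, restrictOp_mul_mulRep_of_eqOn_zero μ H _ h1, zero_mul, zero_mul]
    by_cases h2 : ∀ y ∈ π ⁻¹' {d'}, g y = 0
    · rw [hcalc, restrictOp_mul_mulRep_of_eqOn_zero μ H _ h2, mul_zero]
    push Not at h1 h2
    obtain ⟨y, hy, hfy⟩ := h1
    obtain ⟨z, hz, hgz⟩ := h2
    have h3 := hfg y (subset_tsupport _ hfy) z (subset_tsupport _ hgz)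
    have h4 := dist_le_dist_center_add hc hC y z
    have hy' : π y = d := hy
    have hz' : π z = d' := hz
    rw [hy', hz'] at h4
    have h5 : restrictOp μ H (hπ d) * T * restrictOp μ H (hπ d') = 0 := hT d d' (by linarith)
    rw [hcalc, ← commute_restrictOp_mulRep μ H (hπ d) f]
    calc mulRep μ H f * restrictOp μ H (hπ d) * T * (restrictOp μ H (hπ d') * mulRep μ H g)
        = mulRep μ H f * (restrictOp μ H (hπ d) * T * restrictOp μ H (hπ d')) * mulRep μ H g := by
          simp only [mul_assoc]
      _ = 0 := by rw [h5, mul_zero, zero_mul]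

include hc hC in
/-- The Roe algebra of a proper metric space in terms of a partition into pieces of bounded
diameter. -/
theorem roeL2_eq_gradedRoe (hcC : 0 < C) :
    roeL2 μ H = gradedRoe (isGrading_restrictOp μ H hπ) hfin := by
  have h : {T | IsLocallyCompactOp (mulRep μ H) T ∧ HasFinitePropagation (mulRep μ H) T} =
      (gradedCore (isGrading_restrictOp μ H hπ) hfin : Set (Lp H 2 μ →L[ℂ] Lp H 2 μ)) := by
    ext T
    exact and_congr (isLocallyCompactOp_iff μ H hπ hc hC hfin T)
      (hasFinitePropagation_iff μ H hπ hc hC hcC T)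
  rw [roeL2, roeAlgebra, h, NonUnitalStarAlgebra.adjoin_eq]
  rfl

end RoeGraded

/-! ### Localized orthonormal families -/

section Localized

open ContinuousLinearMap

variable {D : Type*} [MetricSpace D] {E F : Type*}
  [NormedAddCommGroup E] [InnerProductSpace ℂ E] [CompleteSpace E]
  [NormedAddCommGroup F] [InnerProductSpace ℂ F] [CompleteSpace F]

/-- The vectors `a i` are supported within distance `R` of `i`. -/
def LocalizedAt (e : D → E →L[ℂ] E) (a : D → E) (R : ℝ) : Prop :=
  ∀ d i, R < dist d i → e d (a i) = 0

variable {e : D → E →L[ℂ] E} {f : D → F →L[ℂ] F} (he : IsGrading e) (hf : IsGrading f)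
  (hfin : ∀ (d : D) (r : ℝ), (Metric.closedBall d r).Finite)
  {a : D → E} {b : D → F} (ha : Orthonormal ℂ a) (hb : Orthonormal ℂ b) {R R' : ℝ}
  (hea : LocalizedAt e a R) (hfb : LocalizedAt f b R')

theorem isStarProjection_swap_self : IsStarProjection (swap ha ha) :=
  ⟨swap_comp_swap ha ha ha, adjoint_swap ha ha⟩

include hfin in
theorem LocalizedAt.finite (h : LocalizedAt e a R) (d : D) : {i | e d (a i) ≠ 0}.Finite := by
  refine (hfin d R).subset fun i hi => ?_
  by_contra hlt
  rw [Metric.mem_closedBall, not_le, dist_comm] at hlt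
  exact hi (h d i hlt)

include he hfin hea in
theorem LocalizedAt.isCompactOperator_swap_comp (d : D) :
    IsCompactOperator (swap ha hb ∘L e d) := by
  refine isCompactOperator_comp_swap_comp ha hb (ContinuousLinearMap.id ℂ F) (e d) ?_
  refine (LocalizedAt.finite hfin hea d).subset fun i hi => ?_
  rw [he.adjoint_eq] at hi
  exact hi.2

include hfin hfb in
theorem LocalizedAt.isCompactOperator_comp_swap (d : D) :
    IsCompactOperator (f d ∘L swap ha hb) :=
  isCompactOperator_comp_swap_comp ha hb (f d) (ContinuousLinearMap.id ℂ E)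
    ((LocalizedAt.finite hfin hfb d).subset fun _ hi => hi.1)

include he hea hfb in
-- No index `i` can be both within `R'` of `d` and within `R` of `d'`.
theorem LocalizedAt.comp_swap_comp_eq_zero {d d' : D} (h : R + R' < dist d d') :
    f d ∘L swap ha hb ∘L e d' = 0 := by
  refine WannierRoe.comp_swap_comp_eq_zero ha hb (f d) (e d') fun i => ?_
  rw [he.adjoint_eq]
  by_cases h1 : R' < dist d i
  · exact Or.inl (hfb d i h1)
  · refine Or.inr (hea d' i ?_)
    have := dist_triangle d i d'
    rw [dist_comm i d'] at this
    linarith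

include hea in
theorem LocalizedAt.swap_mem_gradedRoe : swap ha ha ∈ gradedRoe he hfin := by
  refine mem_gradedRoe_of_locallyCompact he hfin (fun d =>
    ⟨hea.isCompactOperator_swap_comp he hfin ha ha d,
      hea.isCompactOperator_comp_swap hfin ha ha d⟩)
    -- The maximum with 1 only secures a positive propagation bound, as no sign is imposed on `R`.
    ⟨max (R + R) 1, by positivity, fun d d' h => ?_⟩
  rw [mul_assoc]
  exact LocalizedAt.comp_swap_comp_eq_zero he ha ha hea hea ((le_max_left _ _).trans_lt h)

include he hf hea hfb in
theorem LocalizedAt.cls_eq_zero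
    (hinf : ∀ d, ¬ FiniteDimensional ℂ (LinearMap.range (f d : F →ₗ[ℂ] F)))
    {A : NonUnitalStarSubalgebra ℂ (E →L[ℂ] E)} (hA : A = gradedRoe he hfin)
    {B : NonUnitalStarSubalgebra ℂ (F →L[ℂ] F)} (hB : B = gradedRoe hf hfin)
    (p : A) (hp : IsStarProjection p) (q : B) (hq : IsStarProjection q)
    (hpa : (p : E →L[ℂ] E) = swap ha ha) (hqb : (q : F →L[ℂ] F) = swap hb hb)
    (h : K0.cls p hp = 0) : K0.cls q hq = 0 := by
  refine K0.cls_eq_zero_of_partialIsometry he hf hfin hinf hA hB (U := swap ha hb) ?_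
    (hea.isCompactOperator_swap_comp he hfin ha hb)
    (hfb.isCompactOperator_comp_swap hfin ha hb)
    ⟨max (R + R') 1, by positivity, fun d d' h =>
      LocalizedAt.comp_swap_comp_eq_zero he ha hb hea hfb ((le_max_left _ _).trans_lt h)⟩
    p hp q hq ?_ ?_ h
  · rw [adjoint_swap, swap_comp_swap, swap_comp_swap]
  · rw [hpa, adjoint_swap, swap_comp_swap]
  · rw [hqb, adjoint_swap, swap_comp_swap]

theorem not_finiteDimensional_of_orthonormal {K : Submodule ℂ E} {g : ℕ → E}
    (hg : Orthonormal ℂ g) (hgK : ∀ n, g n ∈ K) : ¬ FiniteDimensional ℂ K := by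
  intro h
  have h1 := (hg.codRestrict K hgK).linearIndependent
  have := h1.finite
  exact not_finite ℕ

theorem isCompactOperator_of_finiteDimensional_range (T : E →L[ℂ] F)
    (h : FiniteDimensional ℂ (LinearMap.range (T : E →ₗ[ℂ] F))) : IsCompactOperator T := by
  have := FiniteDimensional.proper ℂ (LinearMap.range (T : E →ₗ[ℂ] F))
  have h1 : IsCompactOperator T.rangeRestrict :=
    isCompactOperator_of_locallyCompactSpace_dom T.rangeRestrict
  exact h1.clm_comp (LinearMap.range (T : E →ₗ[ℂ] F)).subtypeL

end Localized

/-! ### Uniformly discrete sets -/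

section Discrete

variable {X : Type*} [MetricSpace X] [ProperSpace X] {D : Set X}

/-- A ball of `X` is totally bounded, and a set of radius ε/2 contains at most one point of an
ε-separated set. -/
theorem UniformlyDiscrete.finite_closedBall (hD : UniformlyDiscrete D) (d : D) (r : ℝ) :
    (Metric.closedBall d r).Finite := by
  obtain ⟨ε, hε, hsep⟩ := hD
  obtain ⟨t, ht, hcov⟩ := Metric.totallyBounded_iff.1
    (isCompact_closedBall (d : X) r).totallyBounded (ε / 2) (half_pos hε)
  have h1 : Metric.closedBall d r ⊆ ⋃ y ∈ t, {x : D | dist (x : X) y < ε / 2} := fun x hx => by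
    have hxX : (x : X) ∈ Metric.closedBall (d : X) r := hx
    obtain ⟨y, hy, hxy⟩ := Set.mem_iUnion₂.1 (hcov hxX)
    exact Set.mem_iUnion₂.2 ⟨y, hy, hxy⟩
  refine (ht.biUnion fun y _ => Set.Subsingleton.finite ?_).subset h1
  intro x hx z hz
  by_contra hne
  have h2 := hsep x x.2 z z.2 fun h => hne (Subtype.ext h)
  have h3 := dist_triangle_right (x : X) z y
  have hx' : dist (x : X) y < ε / 2 := hx
  have hz' : dist (z : X) y < ε / 2 := hz
  linarith

theorem countable_of_finite_closedBall {D : Type*} [MetricSpace D]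
    (hfin : ∀ (d : D) (r : ℝ), (Metric.closedBall d r).Finite) : Countable D := by
  rcases isEmpty_or_nonempty D with h | ⟨⟨d⟩⟩
  · infer_instance
  · rw [← Set.countable_univ_iff, ← Metric.iUnion_closedBall_nat d]
    exact Set.countable_iUnion fun n => (hfin d n).countable

theorem properSpace_of_finite_closedBall {D : Type*} [MetricSpace D]
    (hfin : ∀ (d : D) (r : ℝ), (Metric.closedBall d r).Finite) : ProperSpace D :=
  ⟨fun d r => (hfin d r).isCompact⟩

theorem exists_measurable_selection {Y D : Type*} [MeasurableSpace Y] [Countable D]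
    {A : D → Set Y} (hA : ∀ d, MeasurableSet (A d)) (hcov : ∀ y, ∃ d, y ∈ A d) :
    ∃ π : Y → D, (∀ d, MeasurableSet (π ⁻¹' {d})) ∧ ∀ y, y ∈ A (π y) := by
  obtain ⟨ν, hν⟩ := exists_injective_nat D
  have hmin : ∀ y, ∃ d, y ∈ A d ∧ ∀ d', y ∈ A d' → ν d ≤ ν d' := fun y => by
    obtain ⟨d, hd, hd'⟩ := exists_minimalFor_of_wellFoundedLT (fun d => y ∈ A d) ν (hcov y)
    exact ⟨d, hd, fun d' h => (le_total (ν d) (ν d')).elim id fun h' => hd' h h'⟩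
  choose π hπ1 hπ2 using hmin
  refine ⟨π, fun d => ?_, hπ1⟩
  -- Each point chooses the admissible index that comes first in the enumeration `ν`.
  have h : π ⁻¹' {d} = A d \ ⋃ d' ∈ {d' | ν d' < ν d}, A d' := by
    ext y
    simp only [Set.mem_preimage, Set.mem_singleton_iff, Set.mem_sdiff, Set.mem_iUnion, not_exists]
    constructor
    · rintro rfl
      exact ⟨hπ1 y, fun d' hd' hy => absurd (hπ2 y d' hy) (not_le.2 hd')⟩
    · rintro ⟨hy, hd⟩
      refine hν (le_antisymm (hπ2 y d hy) ?_)
      by_contra hlt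
      exact hd _ (not_le.1 hlt) (hπ1 y)
  rw [h]
  exact (hA d).diff (MeasurableSet.biUnion (Set.to_countable _) fun d' _ => hA d')

/-- A coarsely dense, uniformly discrete set is the set of centers of a Borel partition into pieces
of bounded diameter, each a neighbourhood of its center. -/
theorem exists_partition [MeasurableSpace X] [BorelSpace X] (hD : UniformlyDiscrete D)
    (hDX : CoarselyDense D) : ∃ (π : X → D) (C r : ℝ), 0 < C ∧ 0 < r ∧
      (∀ d, MeasurableSet (π ⁻¹' {d})) ∧ (∀ x, dist x (π x : X) ≤ C) ∧
      ∀ d : D, Metric.ball (d : X) r ⊆ π ⁻¹' {d} := by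
  have := countable_of_finite_closedBall hD.finite_closedBall
  obtain ⟨ε, hε, hsep⟩ := hD
  obtain ⟨C, hC, hdense⟩ := hDX
  -- Removing the (ε/2)-balls about all other centers forces each such ball into the piece of its
  -- own center. These balls are disjoint by ε-separation, so their points remain covered; any other
  -- point is within `C` of some center.
  let A : D → Set X := fun d =>
    Metric.ball (d : X) (C + ε) \ ⋃ d' ∈ {d' : D | d' ≠ d}, Metric.ball (d' : X) (ε / 2)
  have hA : ∀ d, MeasurableSet (A d) := fun d =>
    measurableSet_ball.diff (MeasurableSet.biUnion (Set.to_countable _) fun _ _ =>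
      measurableSet_ball)
  have hcov : ∀ x, ∃ d, x ∈ A d := fun x => by
    by_cases h : ∃ d : D, x ∈ Metric.ball (d : X) (ε / 2)
    · obtain ⟨d, hd⟩ := h
      refine ⟨d, Metric.ball_subset_ball (by linarith) hd, fun hx => ?_⟩
      obtain ⟨d', hne, hd'⟩ := Set.mem_iUnion₂.1 hx
      have h1 := hsep d' d'.2 d d.2 fun h => hne (Subtype.ext h)
      have h2 := dist_triangle_left (d' : X) d x
      rw [Metric.mem_ball] at hd hd'
      linarith
    · obtain ⟨y, hy, hxy⟩ := hdense x
      refine ⟨⟨y, hy⟩, Metric.mem_ball.2 (by linarith), fun hx => ?_⟩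
      obtain ⟨d', -, hd'⟩ := Set.mem_iUnion₂.1 hx
      exact h ⟨d', hd'⟩
  obtain ⟨π, hπ1, hπ2⟩ := exists_measurable_selection hA hcov
  refine ⟨π, C + ε, ε / 2, by positivity, half_pos hε, hπ1, fun x => ?_, fun d x hx => ?_⟩
  · exact (Metric.mem_ball.1 (hπ2 x).1).le
  · by_contra hne
    refine (hπ2 x).2 (Set.mem_iUnion₂.2 ⟨d, fun h => hne h.symm, hx⟩)

end Discrete

/-! ### Wannier bases -/

section WannierBasis

variable {X : Type*} [MetricSpace X] [ProperSpace X] [MeasurableSpace X] [BorelSpace X]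
  {μ : Measure X}

/-- The exceptional set is locally null, hence null, a proper metric space being second countable.
-/
theorem ae_mem_essSupp (φ : Lp ℂ 2 μ) : ∀ᵐ y ∂μ, φ y ≠ 0 → y ∈ essSupp φ := by
  rw [ae_iff]
  refine measure_null_of_locally_null _ fun x hx => ?_
  have hx' : ¬ (φ x ≠ 0 → x ∈ essSupp φ) := hx
  rw [Classical.not_imp] at hx'
  have hx2 : ¬ ∀ U ∈ nhds x, ¬ (∀ᵐ y ∂μ.restrict U, φ y = 0) := hx'.2
  push Not at hx2
  obtain ⟨U, hU, hae⟩ := hx2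
  obtain ⟨V, hVU, hV, hxV⟩ := mem_nhds_iff.1 hU
  have h1 : ∀ᵐ y ∂μ, y ∈ V → φ y = 0 :=
    (ae_restrict_iff' hV.measurableSet).1 (ae_restrict_of_ae_restrict_of_subset hVU hae)
  refine ⟨V ∩ {a | ¬ (φ a ≠ 0 → a ∈ essSupp φ)}, ?_, ?_⟩
  · exact Filter.inter_mem (mem_nhdsWithin_of_mem_nhds (hV.mem_nhds hxV)) self_mem_nhdsWithin
  · refine measure_mono_null ?_ (ae_iff.1 h1)
    rintro y ⟨hyV, hy⟩
    have hy' : ¬ (φ y ≠ 0 → y ∈ essSupp φ) := hy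
    exact fun h => (Classical.not_imp.1 hy').1 (h hyV)

variable {D : Set X} {φ : D → Lp ℂ 2 μ} (hφ : IsWannierBasis D φ)
include hφ

theorem IsWannierBasis.orthonormal : Orthonormal ℂ φ := by
  refine ⟨hφ.norm_one, fun i j hij => ?_⟩
  change inner ℂ (φ i) (φ j) = 0
  rw [L2.inner_def]
  refine integral_eq_zero_of_ae ?_
  filter_upwards [ae_mem_essSupp (φ i), ae_mem_essSupp (φ j)] with y hi hj
  by_cases h1 : φ i y = 0
  · simp [h1]
  by_cases h2 : φ j y = 0
  · simp [h2]
  exact (Set.disjoint_left.1 (hφ.disjoint_supp i j hij) (hi h1) (hj h2)).elim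

theorem IsWannierBasis.exists_localizedAt {π : X → D} (hπ : ∀ d, MeasurableSet (π ⁻¹' {d})) {C : ℝ}
    (hC : ∀ x, dist x (π x : X) ≤ C) :
    ∃ R, LocalizedAt (fun d => restrictOp μ ℂ (hπ d)) φ R := by
  obtain ⟨R, hR⟩ := hφ.diam_bdd
  refine ⟨R + C, fun d i hdi => ?_⟩
  rw [restrictOp_apply_eq_zero_iff]
  filter_upwards [ae_mem_essSupp (φ i)] with y hy hyd
  by_contra hne
  have h1 := hR i y (hy hne) i (hφ.mem_supp i)
  have h2 := hC y
  have hyd' : π y = d := hyd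
  rw [hyd'] at h2
  have h3 := dist_triangle_left (d : X) i y
  have h4 : dist (d : X) i = dist d i := rfl
  linarith

/-- Otherwise multiplication by a bump function at `d` would factor through a finite-dimensional
space and be compact, hence zero. Then φ_d would vanish near `d`, contrary to `d` lying in its
support. -/
theorem IsWannierBasis.not_finiteDimensional_range
    (hμ : ∀ f : C₀(X, ℂ), IsCompactOperator (mulRep μ ℂ f) → mulRep μ ℂ f = 0)
    (d : D) {s : Set X} (hs : MeasurableSet s) {r : ℝ} (hr : 0 < r)
    (hrs : Metric.ball (d : X) r ⊆ s) :
    ¬ FiniteDimensional ℂ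
      (LinearMap.range (restrictOp μ ℂ hs : Lp ℂ 2 μ →ₗ[ℂ] Lp ℂ 2 μ)) := by
  intro h
  have hc := isCompactOperator_of_finiteDimensional_range _ h
  obtain ⟨f, hf1, hf2⟩ := exists_bump (d : X) (show r / 3 < r / 2 by linarith)
  have h1 : mulRep μ ℂ f = restrictOp μ ℂ hs * mulRep μ ℂ f := by
    have h2 : restrictOp μ ℂ hs.compl * mulRep μ ℂ f = 0 :=
      restrictOp_mul_mulRep_of_eqOn_zero μ ℂ _ fun y hy => by
        by_contra hne
        exact hy (hrs (Metric.closedBall_subset_ball (by linarith) (hf2 (subset_tsupport _ hne))))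
    conv_lhs => rw [← one_mul (mulRep μ ℂ f), ← restrictOp_add_compl μ ℂ hs, add_mul, h2, add_zero]
  have h3 : mulRep μ ℂ f = 0 := by
    refine hμ f ?_
    rw [h1]
    exact hc.comp_clm _
  refine hφ.mem_supp d (Metric.ball d (r / 3)) (Metric.ball_mem_nhds _ (by positivity)) ?_
  rw [ae_restrict_iff' measurableSet_ball]
  have h4 : mulOp μ ℂ f (φ d) = 0 := DFunLike.congr_fun h3 (φ d)
  have h5 := coeFn_mulOp μ ℂ f (φ d)
  rw [h4] at h5
  filter_upwards [h5, Lp.coeFn_zero ℂ 2 μ] with y hy1 hy2 hy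
  rw [hf1 y (Metric.ball_subset_closedBall hy), one_smul, hy2] at hy1
  exact hy1.symm

end WannierBasis

/-! ### The discrete model -/

section DiscreteModel

open ContinuousLinearMap

variable {D : Type*} [MeasurableSpace D] [MeasurableSingletonClass D]
variable {H : Type*} [NormedAddCommGroup H] [InnerProductSpace ℂ H] [CompleteSpace H]

theorem count_singleton_ne_top (d : D) : (Measure.count {d} : ℝ≥0∞) ≠ ∞ := by simp

/-- The vector `δ_d ⊗ h`. -/
noncomputable def deltaVec (d : D) (h : H) : Lp H 2 (Measure.count : Measure D) :=
  indicatorConstLp 2 (measurableSet_singleton d) (count_singleton_ne_top d) h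

theorem coeFn_deltaVec (d : D) (h : H) :
    deltaVec d h =ᵐ[Measure.count] Set.indicator {d} fun _ => h :=
  indicatorConstLp_coeFn

theorem inner_deltaVec_of_ne {d d' : D} (hne : d ≠ d') (h h' : H) :
    inner ℂ (deltaVec d h) (deltaVec d' h') = 0 := by
  rw [deltaVec, deltaVec, L2.inner_indicatorConstLp_indicatorConstLp _ _ (count_singleton_ne_top d)
    (count_singleton_ne_top d'), Set.singleton_inter_eq_empty.2 (by simpa using hne)]
  simp

theorem inner_deltaVec (d : D) (h h' : H) :
    inner ℂ (deltaVec d h) (deltaVec d h') = inner ℂ h h' := by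
  rw [deltaVec, deltaVec, L2.inner_indicatorConstLp_indicatorConstLp _ _ (count_singleton_ne_top d)
    (count_singleton_ne_top d), Set.inter_self]
  simp [Measure.real]

theorem orthonormal_deltaVec {h : H} (hh : ‖h‖ = 1) : Orthonormal ℂ fun d : D => deltaVec d h := by
  classical
  rw [orthonormal_iff_ite]
  intro i j
  split_ifs with hij
  · subst hij
    rw [inner_deltaVec, inner_self_eq_norm_sq_to_K, hh]
    simp
  · exact inner_deltaVec_of_ne hij h h

theorem restrictOp_deltaVec_self {d : D} {s : Set D} (hs : MeasurableSet s) (hd : d ∈ s) (h : H) :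
    restrictOp Measure.count H hs (deltaVec d h) = deltaVec d h := by
  refine Lp.ext ?_
  filter_upwards [coeFn_restrictOp Measure.count H hs (deltaVec d h),
    coeFn_deltaVec d h] with y h1 h2
  rw [h1]
  by_cases hy : y ∈ s
  · rw [Set.indicator_of_mem hy]
  · rw [Set.indicator_of_notMem hy, h2, Set.indicator_of_notMem]
    rintro rfl
    exact hy hd

theorem restrictOp_deltaVec_of_notMem {d : D} {s : Set D} (hs : MeasurableSet s) (hd : d ∉ s)
    (h : H) : restrictOp Measure.count H hs (deltaVec d h) = 0 := by
  rw [restrictOp_apply_eq_zero_iff]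
  filter_upwards [coeFn_deltaVec d h]
    with y h2 hy
  rw [h2, Set.indicator_of_notMem]
  rintro rfl
  exact hd hy

theorem localizedAt_deltaVec {D : Type*} [MetricSpace D] [MeasurableSpace D]
    [MeasurableSingletonClass D] (hD : ∀ d : D, MeasurableSet (id ⁻¹' {d})) (h : H) :
    LocalizedAt (fun d => restrictOp (Measure.count : Measure D) H (hD d))
      (fun d => deltaVec d h) 0 := by
  intro d i hdi
  refine restrictOp_deltaVec_of_notMem (hD d) (fun hi => ?_) h
  have hi' : i = d := hi
  rw [hi', dist_self] at hdi
  exact lt_irrefl _ hdi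

/-- The vectors δ_d ⊗ g_n, for an orthonormal sequence g_n in `H`, all lie in the range. -/
theorem not_finiteDimensional_range_restrictOp_count (hH : ¬ FiniteDimensional ℂ H) {d : D}
    {s : Set D} (hs : MeasurableSet s) (hd : d ∈ s) :
    ¬ FiniteDimensional ℂ (LinearMap.range (restrictOp Measure.count H hs :
      Lp H 2 (Measure.count : Measure D) →ₗ[ℂ] Lp H 2 (Measure.count : Measure D))) := by
  obtain ⟨g, hg, -⟩ := exists_orthonormal_nat_of_not_finiteDimensional (⊤ : Submodule ℂ H)
    fun h => hH (Module.Finite.equiv (Submodule.topEquiv : (⊤ : Submodule ℂ H) ≃ₗ[ℂ] H))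
  have ho : Orthonormal ℂ fun n => deltaVec d (g n) := by
    classical
    rw [orthonormal_iff_ite] at hg ⊢
    intro i j
    rw [inner_deltaVec, hg]
  exact not_finiteDimensional_of_orthonormal ho
    fun n => ⟨deltaVec d (g n), restrictOp_deltaVec_self hs hd (g n)⟩

theorem ampIso_deltaVec (v : ℂ →ₗᵢ[ℂ] H) (d : D) :
    ampIso Measure.count v (deltaVec d 1) = deltaVec d (v 1) := by
  refine Lp.ext ?_
  filter_upwards [v.toContinuousLinearMap.coeFn_compLpL (deltaVec d 1), coeFn_deltaVec d (1 : ℂ),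
    coeFn_deltaVec d (v 1)] with y h1 h2 h3
  rw [ampIso, h1, h2, h3]
  by_cases hy : y ∈ ({d} : Set D) <;> simp [hy]

theorem adjoint_ampIso_comp_ampIso (v : ℂ →ₗᵢ[ℂ] H) :
    adjoint (ampIso (Measure.count : Measure D) v) ∘L ampIso Measure.count v = 1 := by
  refine ContinuousLinearMap.ext fun x => ext_inner_left ℂ fun y => ?_
  rw [ContinuousLinearMap.comp_apply, adjoint_inner_right]
  change _ = inner ℂ y x
  rw [L2.inner_def, L2.inner_def]
  refine integral_congr_ae ?_
  filter_upwards [v.toContinuousLinearMap.coeFn_compLpL x, v.toContinuousLinearMap.coeFn_compLpL y]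
    with d h1 h2
  rw [ampIso, h1, h2]
  exact v.inner_map_map _ _

theorem eq_zero_of_inner_deltaVec [Countable D] {x : Lp ℂ 2 (Measure.count : Measure D)}
    (h : ∀ d, inner ℂ (deltaVec d (1 : ℂ)) x = 0) : x = 0 := by
  rw [Lp.eq_zero_iff_ae_eq_zero]
  refine Filter.Eventually.of_forall fun d => ?_
  have h1 := h d
  rw [deltaVec, L2.inner_indicatorConstLp_one, integral_singleton] at h1
  simpa [Measure.real] using h1

/-- `V V*` fixes δ_d ⊗ v(1) = V δ_d because `V* V = 1`, and `V*` kills every vector orthogonal to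
all of these. -/
theorem iMap_one_eq_swap [Countable D] (v : ℂ →ₗᵢ[ℂ] H) {h : H} (hv : v 1 = h) (hh : ‖h‖ = 1) :
    iMap (Measure.count : Measure D) v 1 =
      swap (orthonormal_deltaVec hh) (orthonormal_deltaVec hh) := by
  have hV := adjoint_ampIso_comp_ampIso (D := D) v
  subst hv
  refine eq_of_orthonormal (orthonormal_deltaVec hh) (fun d => ?_) fun x hx => ?_
  · rw [swap_apply_self, ← ampIso_deltaVec]
    change ampIso Measure.count v ((adjoint (ampIso Measure.count v) ∘L ampIso Measure.count v)
      (deltaVec d 1)) = _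
    rw [hV]
    rfl
  · rw [swap_eq_zero_of_inner _ _ hx]
    change ampIso Measure.count v (adjoint (ampIso Measure.count v) x) = 0
    rw [eq_zero_of_inner_deltaVec (x := adjoint (ampIso Measure.count v) x), map_zero]
    intro d
    rw [adjoint_inner_right, ampIso_deltaVec]
    exact hx d

end DiscreteModel

end WannierRoe

/-! ### The equivalence of the two vanishing statements -/

theorem theorem2p2 {X : Type*} [MetricSpace X] [ProperSpace X] [MeasurableSpace X] [BorelSpace X]
    (μ : Measure X)
    (hμ : ∀ f : C₀(X, ℂ), IsCompactOperator (WannierRoe.mulRep μ ℂ f) → WannierRoe.mulRep μ ℂ f = 0)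
    {H : Type*} [NormedAddCommGroup H] [InnerProductSpace ℂ H] [CompleteSpace H]
    (hH : ¬ FiniteDimensional ℂ H) (v : ℂ →ₗᵢ[ℂ] H)
    (D : Set X) (hD : WannierRoe.UniformlyDiscrete D) (hDX : WannierRoe.CoarselyDense D)
    (φ : D → Lp ℂ 2 μ) (hφ : WannierRoe.IsWannierBasis D φ) :
    ∃ (p : WannierRoe.roeL2 μ ℂ) (hp : IsStarProjection p)
      (q : WannierRoe.roeL2 (Measure.count : Measure D) H) (hq : IsStarProjection q),
      (p : Lp ℂ 2 μ →L[ℂ] Lp ℂ 2 μ) = WannierRoe.wannierProj φ ∧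
      (q : Lp H 2 (Measure.count : Measure D) →L[ℂ] Lp H 2 (Measure.count : Measure D)) =
        WannierRoe.iMap Measure.count v 1 ∧
      (WannierRoe.K0.cls p hp = 0 ↔ WannierRoe.K0.cls q hq = 0) := by
  have hfin := hD.finite_closedBall
  have hcount : Countable D := WannierRoe.countable_of_finite_closedBall hfin
  have hproper : ProperSpace D := WannierRoe.properSpace_of_finite_closedBall hfin
  refine Exists.elim (WannierRoe.exists_partition hD hDX) fun π h => Exists.elim h fun C h =>
    Exists.elim h fun r h => ?_
  have hC0 := h.1
  have hr := h.2.1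
  have hπ := h.2.2.1
  have hC := h.2.2.2.1
  have hball := h.2.2.2.2
  have hπD : ∀ d : D, MeasurableSet (id ⁻¹' {d}) := fun d => measurableSet_singleton d
  have hv : ‖v 1‖ = 1 := by rw [v.norm_map, norm_one]
  have hA : WannierRoe.roeL2 μ ℂ = _ :=
    WannierRoe.roeL2_eq_gradedRoe μ ℂ hπ isometry_subtype_coe hC hfin hC0
  have hB : WannierRoe.roeL2 (Measure.count : Measure D) H = _ :=
    -- `D` is partitioned into its points; any positive constant bounds the distance to the center.
    WannierRoe.roeL2_eq_gradedRoe Measure.count H hπD isometry_id (C := 1)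
      (fun d => by simp) hfin one_pos
  have he := WannierRoe.isGrading_restrictOp μ ℂ hπ
  have hf := WannierRoe.isGrading_restrictOp (Measure.count : Measure D) H hπD
  have ha := hφ.orthonormal
  have hb := WannierRoe.orthonormal_deltaVec (D := D) hv
  refine Exists.elim (hφ.exists_localizedAt hπ hC) fun R hea => ?_
  have hfb := WannierRoe.localizedAt_deltaVec hπD (v 1)
  have hinfX : ∀ d, ¬ FiniteDimensional ℂ
      (LinearMap.range (WannierRoe.restrictOp μ ℂ (hπ d) : Lp ℂ 2 μ →ₗ[ℂ] Lp ℂ 2 μ)) :=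
    fun d => hφ.not_finiteDimensional_range hμ d (hπ d) hr (hball d)
  have hinfD : ∀ d, ¬ FiniteDimensional ℂ
      (LinearMap.range (WannierRoe.restrictOp (Measure.count : Measure D) H (hπD d) :
        Lp H 2 (Measure.count : Measure D) →ₗ[ℂ] Lp H 2 (Measure.count : Measure D))) :=
    fun d => WannierRoe.not_finiteDimensional_range_restrictOp_count hH (hπD d) rfl
  have hpmem : WannierRoe.swap ha ha ∈ WannierRoe.roeL2 μ ℂ := by
    rw [hA]
    exact hea.swap_mem_gradedRoe he hfin ha
  have hqmem : WannierRoe.swap hb hb ∈ WannierRoe.roeL2 (Measure.count : Measure D) H := by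
    rw [hB]
    exact hfb.swap_mem_gradedRoe hf hfin hb
  have hps := WannierRoe.isStarProjection_swap_self ha
  have hqs := WannierRoe.isStarProjection_swap_self hb
  have hp : IsStarProjection (⟨WannierRoe.swap ha ha, hpmem⟩ : WannierRoe.roeL2 μ ℂ) :=
    ⟨Subtype.ext hps.isIdempotentElem, Subtype.ext hps.isSelfAdjoint⟩
  have hq : IsStarProjection (⟨WannierRoe.swap hb hb, hqmem⟩ :
      WannierRoe.roeL2 (Measure.count : Measure D) H) :=
    ⟨Subtype.ext hqs.isIdempotentElem, Subtype.ext hqs.isSelfAdjoint⟩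
  refine ⟨⟨WannierRoe.swap ha ha, hpmem⟩, hp, ⟨WannierRoe.swap hb hb, hqmem⟩, hq,
    WannierRoe.swap_self_eq_starProjection ha, (WannierRoe.iMap_one_eq_swap v rfl hv).symm, ?_, ?_⟩
  -- Each direction needs infinite-dimensional summands only in its target space.
  · exact hea.cls_eq_zero he hf hfin ha hb hfb hinfD hA hB _ hp _ hq rfl rfl
  · exact hfb.cls_eq_zero hf he hfin hb ha hea hinfX hB hA _ hq _ hp rfl rfl
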